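/- Let $f:\mathbb R\to\mathbb R$ be differentiable with $\inf_{|t|\le s}f'(t)>0$ for all $s>0$ and with $|f|$ and $f'$ bounded above on $\mathbb R$; let $\sigma\ge 0$, $M_X$, $M_0$ and $\rho_X>0$ be constants. There is a constant $K>0$, depending only on $f,\sigma,M_X,\rho_X,M_0$, such that the following holds. For every $n\ge1$ let $d=d_n\ge 1$, let $\theta_0=\theta_{0,n}\in\mathbb R^{d}\setminus\{0\}$ with $|\theta_0|_2\le M_0$ and $s_0$ nonzero coordinates, and let $(X,Y)$ be a random element of $\mathbb R^{d}\times\mathbb R$, with law depending on $n$, such that - $|X|_\infty\le M_X$ almost surely, $E[X]=0$, $E[e^{X^\top v}]\le e^{M_X^2|v|_2^2/2}$ for all $v\in\mathbb R^d$, and the smallest eigenvalue of $E[XX^\top]$ is at least $\rho_X$; - $\epsilon=Y-f(X^\top\theta_0)$ satisfies $\epsilon\mid X\sim\mathcal N(0,\sigma^2)$. Let $(X_1,Y_1),\dots,(X_n,Y_n)$ be i.i.d. copies of $(X,Y)$ and let $$\widehat\theta\in\operatorname*{argmin}_{\theta\in\mathbb R^d}\ \frac1n\sum_{i=1}^n\bigl(Y_i-f(X_i^\top\theta)\bigr)^2+\lambda_n|\theta|_1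 .$$ If $\log(nd)\,|\theta_0|_1^2/n\to0$ as $n\to\infty$, if $\lambda_n\ge K\sqrt{\log(4nd)/n}$ for all $n\ge1$, and if $\lambda_n$ is of this order, that is $\lambda_n=O\bigl(\sqrt{\log(4nd)/n}\bigr)$, then $$|\widehat\theta-\theta_0|_1=O_P\!\left(s_0\sqrt{\frac{\log(nd)}{n}}\right).$$ -/

import Mathlib

open MeasureTheory ProbabilityTheory Filter Topology
open scoped NNReal ENNReal

noncomputable section

namespace SparseNLS

/-- The `ℓ₁` norm of a vector of `ℝᵈ` (whose ambient norm is the Euclidean one). -/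
def l1Norm {d : ℕ} (θ : EuclideanSpace ℝ (Fin d)) : ℝ := ∑ j, |θ j|

/-- The number of nonzero coordinates of a vector. -/
def numNonzero {d : ℕ} (θ : EuclideanSpace ℝ (Fin d)) : ℕ := Set.ncard {j | θ j ≠ 0}

/-- Regularity of the link function: it is differentiable, its derivative is bounded away from
zero on every interval `[-s, s]`, and `|f|` and `f'` are bounded above. -/
structure IsRegularLink (f : ℝ → ℝ) : Prop where
  differentiable : Differentiable ℝ f
  deriv_pos : ∀ s > 0, ∃ c > 0, ∀ t, |t| ≤ s → c ≤ deriv f t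
  bounded : ∃ M : ℝ, ∀ t, |f t| ≤ M ∧ deriv f t ≤ M

/-- The matrix `E[X Xᵀ]`, where `(X, Y)` has law `P`. -/
def secondMoment {d : ℕ} (P : Measure (EuclideanSpace ℝ (Fin d) × ℝ)) :
    Matrix (Fin d) (Fin d) ℝ :=
  Matrix.of fun j k => ∫ z, z.1 j * z.1 k ∂P

/-- Conditions on the covariate vector `X`, where `(X, Y)` has law `P`: it is bounded by `M` in
sup norm, centred, `M²` sub-Gaussian, and the smallest eigenvalue of `E[X Xᵀ]` is at least `ρ`. -/
structure IsRegularDesign {d : ℕ} (M ρ : ℝ) (P : Measure (EuclideanSpace ℝ (Fin d) × ℝ)) :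
    Prop where
  bounded : ∀ᵐ z ∂P, ∀ j, |z.1 j| ≤ M
  mean_zero : ∀ j, ∫ z, z.1 j ∂P = 0
  subGaussian : ∀ v : EuclideanSpace ℝ (Fin d),
    ∫ z, Real.exp (inner ℝ z.1 v) ∂P ≤ Real.exp (M ^ 2 * ‖v‖ ^ 2 / 2)
  eigenvalue_ge : ∀ κ : ℝ,
    Module.End.HasEigenvalue (Matrix.toLin' (secondMoment P)) κ → ρ ≤ κ

/-- The single-index model: when `(X, Y)` has law `P`, the conditional law of
`ε = Y - f (Xᵀ θ₀)` given `X` is `𝒩(0, σ²)`. -/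
def IsGaussianSingleIndex {d : ℕ} (f : ℝ → ℝ) (σ : ℝ≥0) (θ₀ : EuclideanSpace ℝ (Fin d))
    (P : Measure (EuclideanSpace ℝ (Fin d) × ℝ)) : Prop :=
  HasCondDistrib (fun z : EuclideanSpace ℝ (Fin d) × ℝ => z.2 - f (inner ℝ z.1 θ₀)) Prod.fst
    (Kernel.const (EuclideanSpace ℝ (Fin d)) (gaussianReal 0 (σ ^ 2))) P

/-- The penalized least-squares criterion
`(1/n) ∑ᵢ (Yᵢ - f (Xᵢᵀ θ))² + lam |θ|₁` at the data `z i = (Xᵢ, Yᵢ)`. -/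
def criterion {n d : ℕ} (f : ℝ → ℝ) (lam : ℝ) (z : Fin n → EuclideanSpace ℝ (Fin d) × ℝ)
    (θ : EuclideanSpace ℝ (Fin d)) : ℝ :=
  (1 / (n : ℝ)) * ∑ i, ((z i).2 - f (inner ℝ (z i).1 θ)) ^ 2 + lam * l1Norm θ

/-- `W n = O_P(r n)` as `n → ∞`, where `W n` lives on the probability space `(Ω n, μ n)`. -/
def IsBigOP {Ω : ℕ → Type*} [∀ n, MeasurableSpace (Ω n)] (μ : ∀ n, Measure (Ω n))
    (W : ∀ n, Ω n → ℝ) (r : ℕ → ℝ) : Prop :=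
  ∀ δ : ℝ, 0 < δ → ∃ C : ℝ, 0 < C ∧
    ∀ᶠ n in atTop, μ n {ω | C * |r n| < |W n ω|} ≤ ENNReal.ofReal δ

end SparseNLS

end

namespace SparseNLS

/-! ### Rademacher contraction -/

/-! Write `θhat = θ₀ + h`. Comparing the criterion at `θhat` and at `θ₀` (`basic_inequality`) bounds
the empirical excess risk `Q`, the mean of `(f (Xᵢᵀ (θ₀ + h)) - f (Xᵢᵀ θ₀))²`, by a noise term plus
`lam * (|θ₀|₁ - |θ₀ + h|₁)`. Two random events then suffice, and the rest is deterministic.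

Noise (`measure_noise_event_le`): Gaussian noise is symmetric, so the contraction principle applies
to the Lipschitz `f` and replaces the process over an `ℓ₁` ball by `d` linear sums, whose
exponential moments are explicit. Peeling over radii gives a bound proportional to `rate * (|h|₁ +
1/n)`, uniform in `h`. Once `lam ≥ K * rate` this costs half of the penalty, whence `|h|₁ ≤ 4 √s₀
‖h‖ + 1/n` and also `|h|₁ ≤ 4 |θ₀|₁ + 1/n`. Here `K` depends only on `f`, `σ` and `M_X`.

Curvature (`measure_truncSq_cone_le`, `empirical_growth`): `f'` may decay at infinity, so only
indices with `|Xᵢᵀ θ₀| ≤ τ` are used, and squares are capped. Fourth moments show that half of `ρ`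
survives truncation. The capped square is Lipschitz, so symmetrization and contraction give a
uniform empirical lower bound on the cone `|h|₁ ≤ (a / rate) ‖h‖`. The resulting growth is `Q ≥ κ
min (‖h‖²) (1/τ²)`.

Conclusion (`error_bound_of_growth`): the saturated value `1/τ²` is impossible because `Q` is at
most of order `rate * |θ₀|₁`, which tends to `0`. The quadratic value gives the rate. Outside the
cone `√s₀ * rate` is bounded below, and the crude bound `|h|₁ ≤ 8 |θ₀|₁` already suffices; no
smallness of `s₀ * rate` is needed. -/

/-- The sign attached to a Boolean. -/
noncomputable def boolSign (b : Bool) : ℝ := if b then 1 else -1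

@[simp] lemma boolSign_true : boolSign true = 1 := rfl
@[simp] lemma boolSign_false : boolSign false = -1 := rfl

/-- Majorization inequality for the exponential. -/
lemma exp_add_exp_le {x y U V : ℝ} (hx : x ≤ max U V) (hy : y ≤ max U V) (hxy : x + y ≤ U + V) :
    Real.exp x + Real.exp y ≤ Real.exp U + Real.exp V := by
  wlog h : V ≤ U generalizing U V
  · rw [add_comm (Real.exp U)]
    exact this (by rwa [max_comm]) (by rwa [max_comm]) (by linarith) (by linarith)
  rw [max_eq_left h] at hx hy
  have h1 : Real.exp x ≤ Real.exp U := Real.exp_le_exp.2 hx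
  have h2 : Real.exp y ≤ Real.exp U := Real.exp_le_exp.2 hy
  have h3 : Real.exp x * Real.exp y ≤ Real.exp U * Real.exp V := by
    rw [← Real.exp_add, ← Real.exp_add]
    exact Real.exp_le_exp.2 hxy
  have h4 := Real.exp_pos U
  -- Expand `(e^U - e^x)(e^U - e^y) ≥ 0`, use `e^(x+y) ≤ e^(U+V)`, and divide by `e^U`.
  nlinarith [mul_nonneg (sub_nonneg.2 h1) (sub_nonneg.2 h2)]

/-- Contraction for a single sign. At maximizers of the two left suprema, `|p| ≤ |b|` puts each
exponent below the larger right one, and the Lipschitz bound, read according to the sign of `b t - b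
s`, bounds their sum; `exp_add_exp_le` concludes. -/
lemma exp_sup'_add_exp_sup'_le {ι : Type*} (T : Finset ι) (hT : T.Nonempty) (a p b : ι → ℝ)
    (hlip : ∀ s ∈ T, ∀ t ∈ T, |p s - p t| ≤ |b s - b t|) (habs : ∀ t ∈ T, |p t| ≤ |b t|) :
    Real.exp (T.sup' hT fun t => a t + p t) + Real.exp (T.sup' hT fun t => a t - p t) ≤
      Real.exp (T.sup' hT fun t => a t + b t) + Real.exp (T.sup' hT fun t => a t - b t) := by
  obtain ⟨t, ht, hte⟩ := Finset.exists_mem_eq_sup' hT fun t => a t + p t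
  obtain ⟨s, hs, hse⟩ := Finset.exists_mem_eq_sup' hT fun t => a t - p t
  rw [hte, hse]
  have hU : ∀ r ∈ T, a r + b r ≤ T.sup' hT fun t => a t + b t :=
    fun r hr => Finset.le_sup' (fun t => a t + b t) hr
  have hV : ∀ r ∈ T, a r - b r ≤ T.sup' hT fun t => a t - b t :=
    fun r hr => Finset.le_sup' (fun t => a t - b t) hr
  have hmax : ∀ r ∈ T, a r + |b r| ≤
      max (T.sup' hT fun t => a t + b t) (T.sup' hT fun t => a t - b t) := by
    intro r hr
    rcases abs_cases (b r) with ⟨h, _⟩ | ⟨h, _⟩ <;> rw [h]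
    · exact le_max_of_le_left (hU r hr)
    · exact le_max_of_le_right (hV r hr)
  refine exp_add_exp_le ?_ ?_ ?_
  · linarith [hmax t ht, habs t ht, le_abs_self (p t)]
  · linarith [hmax s hs, habs s hs, neg_abs_le (p s)]
  · have h1 := hlip t ht s hs
    have h2 := le_abs_self (p t - p s)
    rcases abs_cases (b t - b s) with ⟨h, _⟩ | ⟨h, _⟩
    · linarith [hU t ht, hV s hs]
    · linarith [hU s hs, hV t ht]

lemma sum_fin_succ_bool {n : ℕ} (F : (Fin (n + 1) → Bool) → ℝ) :
    ∑ η, F η = ∑ η : Fin n → Bool, (F (Fin.cons true η) + F (Fin.cons false η)) := by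
  rw [← (Fin.consEquiv fun _ => Bool).sum_comp, Fintype.sum_prod_type, Fintype.sum_bool,
    Finset.sum_add_distrib]
  rfl

/-- The contraction principle for Rademacher averages, in exponential form. -/
theorem sum_exp_sup'_le_of_contraction {ι : Type*} (T : Finset ι) (hT : T.Nonempty) {n : ℕ}
    (a : ι → ℝ) (p b : ι → Fin n → ℝ)
    (hlip : ∀ i, ∀ s ∈ T, ∀ t ∈ T, |p s i - p t i| ≤ |b s i - b t i|)
    (habs : ∀ i, ∀ t ∈ T, |p t i| ≤ |b t i|) :
    ∑ η : Fin n → Bool, Real.exp (T.sup' hT fun t => a t + ∑ i, boolSign (η i) * p t i) ≤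
      ∑ η : Fin n → Bool, Real.exp (T.sup' hT fun t => a t + ∑ i, boolSign (η i) * b t i) := by
  induction n generalizing a with
  | zero => simp
  | succ n ih =>
    rw [sum_fin_succ_bool, sum_fin_succ_bool, Finset.sum_add_distrib]
    -- With the first sign fixed, its term is absorbed in the offset `a`, which is why `a` is
    -- generalized. The other coordinates are contracted first, then the first one.
    have h1 := ih (fun t => a t + p t 0) (fun t i => p t i.succ) (fun t i => b t i.succ)
      (fun i => hlip i.succ) (fun i => habs i.succ)
    have h2 := ih (fun t => a t - p t 0) (fun t i => p t i.succ) (fun t i => b t i.succ)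
      (fun i => hlip i.succ) (fun i => habs i.succ)
    have h3 : ∀ η : Fin n → Bool, _ := fun η =>
      exp_sup'_add_exp_sup'_le T hT (fun t => a t + ∑ i : Fin n, boolSign (η i) * b t i.succ)
        (fun t => p t 0) (fun t => b t 0) (hlip 0) (habs 0)
    have h4 := Finset.sum_le_sum fun η (_ : η ∈ (Finset.univ : Finset (Fin n → Bool))) => h3 η
    rw [Finset.sum_add_distrib] at h4
    simp only [Fin.sum_univ_succ, Fin.cons_zero, Fin.cons_succ, boolSign_true, boolSign_false,
      one_mul, neg_mul, ← add_assoc, ← sub_eq_add_neg]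
    refine (add_le_add h1 h2).trans ?_
    convert h4 using 4
    all_goals (congr 1; ext t; ring)

/-! ### The `ℓ₁` norm and reduction to coordinates. -/

lemma l1Norm_nonneg {d : ℕ} (h : EuclideanSpace ℝ (Fin d)) : 0 ≤ l1Norm h :=
  Finset.sum_nonneg fun _ _ => abs_nonneg _

lemma inner_eq_sum {d : ℕ} (x h : EuclideanSpace ℝ (Fin d)) : inner ℝ x h = ∑ j, x j * h j := by
  simp [PiLp.inner_apply, mul_comm]

/-- Duality between the `ℓ₁` norm and the maximum of the coordinates, in exponential form. -/
lemma exp_sum_mul_le {d : ℕ} (hd : 1 ≤ d) (h : EuclideanSpace ℝ (Fin d)) {R : ℝ}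
    (hR : l1Norm h ≤ R) (S : Fin d → ℝ) :
    Real.exp (∑ j, S j * h j) ≤ ∑ j, (Real.exp (R * S j) + Real.exp (-(R * S j))) := by
  have : Nonempty (Fin d) := ⟨⟨0, hd⟩⟩
  obtain ⟨k, -, hk⟩ := Finset.exists_max_image Finset.univ (fun j => |S j|) Finset.univ_nonempty
  have h1 : ∑ j, S j * h j ≤ R * |S k| := by
    calc ∑ j, S j * h j ≤ ∑ j, |S k| * |h j| := Finset.sum_le_sum fun j _ =>
          (le_abs_self _).trans (by
            rw [abs_mul]
            exact mul_le_mul_of_nonneg_right (hk j (Finset.mem_univ j)) (abs_nonneg _))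
      _ = l1Norm h * |S k| := by rw [← Finset.mul_sum, mul_comm]; rfl
      _ ≤ R * |S k| := mul_le_mul_of_nonneg_right hR (abs_nonneg _)
  have h2 : Real.exp (R * |S k|) ≤ Real.exp (R * S k) + Real.exp (-(R * S k)) := by
    rcases abs_cases (S k) with ⟨e, _⟩ | ⟨e, _⟩ <;> rw [e]
    · linarith [Real.exp_pos (-(R * S k))]
    · rw [mul_neg]; linarith [Real.exp_pos (R * S k)]
  refine (Real.exp_le_exp.2 h1).trans (h2.trans ?_)
  exact Finset.single_le_sum (f := fun j => Real.exp (R * S j) + Real.exp (-(R * S j)))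
    (fun j _ => by positivity) (Finset.mem_univ k)

/-- The contraction principle over a subset of an `ℓ₁` ball. -/
theorem sum_exp_sup'_le_sum_coord {d n : ℕ} (hd : 1 ≤ d) (T : Finset (EuclideanSpace ℝ (Fin d)))
    (hT : T.Nonempty) (p : EuclideanSpace ℝ (Fin d) → Fin n → ℝ)
    (x : Fin n → EuclideanSpace ℝ (Fin d)) (w : Fin n → ℝ) {R : ℝ}
    (hR : ∀ h ∈ T, l1Norm h ≤ R)
    (hlip : ∀ i, ∀ s ∈ T, ∀ t ∈ T, |p s i - p t i| ≤ |w i * (inner ℝ (x i) s - inner ℝ (x i) t)|)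
    (habs : ∀ i, ∀ t ∈ T, |p t i| ≤ |w i * inner ℝ (x i) t|) :
    ∑ η : Fin n → Bool, Real.exp (T.sup' hT fun t => ∑ i, boolSign (η i) * p t i) ≤
      ∑ η : Fin n → Bool, ∑ j,
        (Real.exp (R * ∑ i, boolSign (η i) * (w i * x i j)) +
          Real.exp (-(R * ∑ i, boolSign (η i) * (w i * x i j)))) := by
  -- The comparison process is linear in `t`, so duality trades its supremum for a sum over `d`
  -- signed coordinates; this is the source of `log d`.
  have h1 := sum_exp_sup'_le_of_contraction T hT (fun _ => 0) p
    (fun t i => w i * inner ℝ (x i) t)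
    (fun i s hs t ht => by rw [← mul_sub]; exact hlip i s hs t ht) habs
  simp only [zero_add] at h1
  refine h1.trans (Finset.sum_le_sum fun η _ => ?_)
  obtain ⟨t, ht, hte⟩ := Finset.exists_mem_eq_sup' hT
    fun t => ∑ i, boolSign (η i) * (w i * inner ℝ (x i) t)
  rw [hte]
  refine le_trans (le_of_eq ?_) (exp_sum_mul_le hd t (hR t ht)
    fun j => ∑ i, boolSign (η i) * (w i * x i j))
  congr 1
  simp only [inner_eq_sum, Finset.mul_sum, Finset.sum_mul]
  rw [Finset.sum_comm]
  exact Finset.sum_congr rfl fun j _ => Finset.sum_congr rfl fun i _ => by ring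

/-! ### Symmetrization on finite product spaces -/

section Symmetrization

variable {𝒳 : Type*} [MeasurableSpace 𝒳]

/-- Apply the map `ι` to the coordinates whose sign is negative. -/
def flipCoords {n : ℕ} (ι : 𝒳 → 𝒳) (η : Fin n → Bool) (x : Fin n → 𝒳) : Fin n → 𝒳 :=
  fun i => if η i then x i else ι (x i)

lemma measurePreserving_flipCoords {n : ℕ} {Q : Measure 𝒳} [SigmaFinite Q] {ι : 𝒳 → 𝒳}
    (hι : MeasurePreserving ι Q Q) (η : Fin n → Bool) :
    MeasurePreserving (flipCoords ι η) (Measure.pi fun _ => Q) (Measure.pi fun _ => Q) := by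
  have := measurePreserving_pi (fun _ : Fin n => Q) (fun _ => Q)
    (f := fun i x => if η i then x else ι x) (fun i => by
      cases h : η i
      · simpa [h] using hι
      · simp only [if_true]
        exact MeasurePreserving.id Q)
  exact this

lemma sum_lintegral_flipCoords {n : ℕ} {Q : Measure 𝒳} [SigmaFinite Q] {ι : 𝒳 → 𝒳}
    (hι : MeasurePreserving ι Q Q) {F : (Fin n → 𝒳) → ℝ≥0∞} (hF : Measurable F) :
    ∫⁻ x, ∑ η : Fin n → Bool, F (flipCoords ι η x) ∂(Measure.pi fun _ => Q) =
      2 ^ n * ∫⁻ x, F x ∂(Measure.pi fun _ => Q) := by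
  have hm : ∀ η ∈ (Finset.univ : Finset (Fin n → Bool)),
      Measurable fun x => F (flipCoords ι η x) :=
    fun η _ => hF.comp (measurePreserving_flipCoords hι η).measurable
  rw [lintegral_finsetSum _ hm, Finset.sum_congr rfl fun η _ =>
    (measurePreserving_flipCoords hι η).lintegral_comp hF]
  simp

/-- Comparison of two functions by comparison of their averages over sign flips. -/
lemma lintegral_le_of_sum_flipCoords_le {n : ℕ} {Q : Measure 𝒳} [SigmaFinite Q] {ι : 𝒳 → 𝒳}
    (hι : MeasurePreserving ι Q Q) {F G : (Fin n → 𝒳) → ℝ≥0∞} (hF : Measurable F)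
    (hG : Measurable G)
    (h : ∀ x, ∑ η : Fin n → Bool, F (flipCoords ι η x) ≤
      ∑ η : Fin n → Bool, G (flipCoords ι η x)) :
    ∫⁻ x, F x ∂(Measure.pi fun _ => Q) ≤ ∫⁻ x, G x ∂(Measure.pi fun _ => Q) := by
  have h1 : (2 : ℝ≥0∞) ^ n * ∫⁻ x, F x ∂(Measure.pi fun _ => Q) ≤
      2 ^ n * ∫⁻ x, G x ∂(Measure.pi fun _ => Q) := by
    rw [← sum_lintegral_flipCoords hι hF, ← sum_lintegral_flipCoords hι hG]
    exact lintegral_mono h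
  exact (ENNReal.mul_le_mul_iff_right (by simp) (by finiteness)).1 h1

/-- The exponential moment of a sum over a product space. -/
lemma lintegral_exp_sum_pi_le {n : ℕ} {Q : Measure 𝒳} [IsProbabilityMeasure Q] {q : 𝒳 → ℝ}
    (hq : Integrable (fun x => Real.exp (q x)) Q) {c : ℝ}
    (hc : ∫ x, Real.exp (q x) ∂Q ≤ Real.exp c) :
    ∫⁻ x, ENNReal.ofReal (Real.exp (∑ i, q (x i))) ∂(Measure.pi fun _ : Fin n => Q) ≤
      ENNReal.ofReal (Real.exp (n * c)) := by
  have h1 := Integrable.fintype_prod (ι := Fin n) (μ := fun _ => Q) fun _ => hq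
  simp only [Real.exp_sum]
  rw [← ofReal_integral_eq_lintegral_ofReal h1
    (ae_of_all _ fun x => Finset.prod_nonneg fun i _ => (Real.exp_pos _).le)]
  refine ENNReal.ofReal_le_ofReal ?_
  have h2 := integral_fintype_prod_eq_prod (μ := fun _ : Fin n => Q)
    (fun _ : Fin n => fun x => Real.exp (q x))
  rw [h2, Finset.prod_const, Finset.card_univ, Fintype.card_fin, Real.exp_nat_mul]
  exact pow_le_pow_left₀ (integral_nonneg fun x => (Real.exp_pos _).le) hc n

end Symmetrization

/-! ### Exponential moments of the noise process -/

lemma measurePreserving_neg_gaussian (v : ℝ≥0) :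
    MeasurePreserving (fun x : ℝ => -x) (gaussianReal 0 v) (gaussianReal 0 v) :=
  ⟨measurable_neg, by
    have := gaussianReal_map_neg (μ := 0) (v := v)
    simpa using this⟩

lemma measurePreserving_flip_noise {E : Type*} [MeasurableSpace E] (ν : Measure E)
    [IsProbabilityMeasure ν] (v : ℝ≥0) :
    MeasurePreserving (fun z : E × ℝ => (z.1, -z.2)) (ν.prod (gaussianReal 0 v))
      (ν.prod (gaussianReal 0 v)) :=
  (MeasurePreserving.id ν).prod (measurePreserving_neg_gaussian v)

/-- A bounded variable times an independent Gaussian has a Gaussian exponential moment. -/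
lemma integral_exp_mul_gaussian_le {E : Type*} [MeasurableSpace E] {ν : Measure E}
    [IsProbabilityMeasure ν] {v : ℝ≥0} {u : E → ℝ} (hu : Measurable u) {M : ℝ}
    (hM : ∀ᵐ x ∂ν, |u x| ≤ M) :
    Integrable (fun z : E × ℝ => Real.exp (u z.1 * z.2)) (ν.prod (gaussianReal 0 v)) ∧
      ∫ z, Real.exp (u z.1 * z.2) ∂(ν.prod (gaussianReal 0 v)) ≤ Real.exp (v * M ^ 2 / 2) := by
  have hmgf : ∀ t : ℝ, ∫ x, Real.exp (t * x) ∂(gaussianReal 0 v) = Real.exp (v * t ^ 2 / 2) := by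
    intro t
    have := congrFun (mgf_id_gaussianReal (μ := 0) (v := v)) t
    simpa [mgf] using this
  have hle : ∀ᵐ x ∂ν, Real.exp (v * u x ^ 2 / 2) ≤ Real.exp (v * M ^ 2 / 2) := by
    filter_upwards [hM] with x hx
    have : u x ^ 2 ≤ M ^ 2 := by
      rw [← sq_abs]; exact pow_le_pow_left₀ (abs_nonneg _) hx 2
    gcongr
  have hint : Integrable (fun x => Real.exp (v * u x ^ 2 / 2)) ν := by
    refine Integrable.of_bound (C := Real.exp (v * M ^ 2 / 2)) (by fun_prop) ?_
    filter_upwards [hle] with x hx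
    rwa [Real.norm_eq_abs, abs_of_pos (Real.exp_pos _)]
  have hI : Integrable (fun z : E × ℝ => Real.exp (u z.1 * z.2))
      (ν.prod (gaussianReal 0 v)) := by
    rw [integrable_prod_iff (by fun_prop)]
    refine ⟨ae_of_all _ fun x => integrable_exp_mul_gaussianReal (u x), ?_⟩
    simpa [Real.norm_eq_abs, abs_of_pos (Real.exp_pos _), hmgf] using hint
  refine ⟨hI, ?_⟩
  rw [integral_prod _ hI]
  simp only [hmgf]
  calc _ ≤ ∫ _, Real.exp (v * M ^ 2 / 2) ∂ν := integral_mono_ae hint (integrable_const _) hle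
    _ = _ := by simp

/-- The law of `(X, ε)` in the model. -/
noncomputable def noiseLaw {d : ℕ} (σ : ℝ≥0) (ν : Measure (EuclideanSpace ℝ (Fin d))) :
    Measure (EuclideanSpace ℝ (Fin d) × ℝ) :=
  ν.prod (gaussianReal 0 (σ ^ 2))

instance {d : ℕ} (σ : ℝ≥0) (ν : Measure (EuclideanSpace ℝ (Fin d))) [IsProbabilityMeasure ν] :
    IsProbabilityMeasure (noiseLaw σ ν) := by unfold noiseLaw; infer_instance

lemma measurable_sup'_real {α ι : Type*} [MeasurableSpace α] (T : Finset ι) (hT : T.Nonempty)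
    {g : ι → α → ℝ} (hg : ∀ t ∈ T, Measurable (g t)) :
    Measurable fun x => T.sup' hT fun t => g t x := by
  have := Finset.measurable_sup' hT hg
  convert this using 1
  ext x
  simp [Finset.sup'_apply]

/-- Exponential moment of the supremum of the noise process over a finite part of an `ℓ₁` ball. -/
theorem lintegral_exp_sup'_noise_le {d n : ℕ} (hd : 1 ≤ d) {f : ℝ → ℝ} {L : ℝ} (hL : 0 ≤ L)
    (hf : ∀ s t, |f s - f t| ≤ L * |s - t|) {σ : ℝ≥0} {ν : Measure (EuclideanSpace ℝ (Fin d))}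
    [IsProbabilityMeasure ν] {M : ℝ} (hM : ∀ᵐ x ∂ν, ∀ j, |x j| ≤ M)
    (θ₀ : EuclideanSpace ℝ (Fin d)) (T : Finset (EuclideanSpace ℝ (Fin d)))
    (hT : T.Nonempty) {R s : ℝ} (hR : ∀ h ∈ T, l1Norm h ≤ R) (hR0 : 0 ≤ R) (hs : 0 ≤ s) :
    ∫⁻ z, ENNReal.ofReal (Real.exp (T.sup' hT fun h => ∑ i : Fin n,
        s * ((z i).2 * (f (inner ℝ (z i).1 (θ₀ + h)) - f (inner ℝ (z i).1 θ₀)))))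
        ∂(Measure.pi fun _ => noiseLaw σ ν) ≤
      2 * d * ENNReal.ofReal (Real.exp (n * (σ ^ 2 * (R * s * L * M) ^ 2 / 2))) := by
  have hfm : Measurable f := by
    have : LipschitzWith ⟨L, hL⟩ f := LipschitzWith.of_dist_le_mul fun x y => by
      rw [Real.dist_eq, Real.dist_eq]; exact hf x y
    exact this.continuous.measurable
  -- The contracted bound with the random signs reabsorbed in the noise. Only its average over sign
  -- flips dominates the integrand, which is enough by invariance of the law; its integral is a
  -- Gaussian moment computation.
  let G : (Fin n → EuclideanSpace ℝ (Fin d) × ℝ) → ℝ≥0∞ := fun z => ∑ j,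
    (ENNReal.ofReal (Real.exp (∑ i, (R * s * L * (z i).1 j) * (z i).2)) +
      ENNReal.ofReal (Real.exp (∑ i, (-(R * s * L * (z i).1 j)) * (z i).2)))
  have hGm : Measurable G := by fun_prop
  have key : ∀ j : Fin d, ∀ c : ℝ, |c| = R * s * L →
      ∫⁻ z, ENNReal.ofReal (Real.exp (∑ i : Fin n, (c * (z i).1 j) * (z i).2))
        ∂(Measure.pi fun _ => noiseLaw σ ν) ≤
      ENNReal.ofReal (Real.exp (n * (σ ^ 2 * (R * s * L * M) ^ 2 / 2))) := by
    intro j c hc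
    have := integral_exp_mul_gaussian_le (ν := ν) (v := σ ^ 2)
      (u := fun x : EuclideanSpace ℝ (Fin d) => c * x j) (by fun_prop) (M := R * s * L * M) (by
        filter_upwards [hM] with x hx
        rw [abs_mul, hc]
        exact mul_le_mul_of_nonneg_left (hx j) (by positivity))
    refine lintegral_exp_sum_pi_le (Q := noiseLaw σ ν)
      (q := fun z : EuclideanSpace ℝ (Fin d) × ℝ => (c * z.1 j) * z.2) this.1 ?_
    simpa [noiseLaw] using this.2
  have hflip : ∫⁻ z, ENNReal.ofReal (Real.exp (T.sup' hT fun h => ∑ i : Fin n,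
        s * ((z i).2 * (f (inner ℝ (z i).1 (θ₀ + h)) - f (inner ℝ (z i).1 θ₀)))))
        ∂(Measure.pi fun _ => noiseLaw σ ν) ≤ ∫⁻ z, G z ∂(Measure.pi fun _ => noiseLaw σ ν) := by
    refine lintegral_le_of_sum_flipCoords_le
      (measurePreserving_flip_noise ν (σ ^ 2)) ?_ hGm fun z => ?_
    · refine (Real.measurable_exp.comp (measurable_sup'_real T hT fun h _ => ?_)).ennreal_ofReal
      fun_prop
    · have h1 := sum_exp_sup'_le_sum_coord hd T hT
        (fun h i => s * ((z i).2 * (f (inner ℝ (z i).1 (θ₀ + h)) - f (inner ℝ (z i).1 θ₀))))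
        (fun i => (z i).1) (fun i => s * L * (z i).2) hR
        (fun i h _ k _ => by
          rw [← mul_sub, ← mul_sub, sub_sub_sub_cancel_right, abs_mul, abs_mul, abs_mul, abs_mul,
            abs_mul, abs_of_nonneg hs, abs_of_nonneg hL]
          have := hf (inner ℝ (z i).1 (θ₀ + h)) (inner ℝ (z i).1 (θ₀ + k))
          rw [inner_add_right, inner_add_right, add_sub_add_left_eq_sub] at this
          rw [inner_add_right, inner_add_right]
          have h3 : 0 ≤ s * |(z i).2| := by positivity
          nlinarith [mul_le_mul_of_nonneg_left this h3])
        (fun i h _ => by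
          rw [abs_mul, abs_mul, abs_mul, abs_mul, abs_mul, abs_of_nonneg hs, abs_of_nonneg hL]
          have := hf (inner ℝ (z i).1 (θ₀ + h)) (inner ℝ (z i).1 θ₀)
          rw [inner_add_right, add_sub_cancel_left] at this
          rw [inner_add_right]
          have h3 : 0 ≤ s * |(z i).2| := by positivity
          nlinarith [mul_le_mul_of_nonneg_left this h3])
      have e1 : ∀ η : Fin n → Bool, ∀ i, (flipCoords
          (fun z : EuclideanSpace ℝ (Fin d) × ℝ => (z.1, -z.2)) η z i) =
          ((z i).1, boolSign (η i) * (z i).2) := by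
        intro η i
        unfold flipCoords
        cases η i <;> simp
      simp only [G, e1]
      rw [← ENNReal.ofReal_sum_of_nonneg fun _ _ => (Real.exp_pos _).le]
      simp only [← ENNReal.ofReal_add (Real.exp_pos _).le (Real.exp_pos _).le]
      simp only [← ENNReal.ofReal_sum_of_nonneg
        fun (i : Fin d) (_ : i ∈ Finset.univ) => add_nonneg (Real.exp_pos _).le (Real.exp_pos _).le]
      rw [← ENNReal.ofReal_sum_of_nonneg fun _ _ => Finset.sum_nonneg fun _ _ =>
        add_nonneg (Real.exp_pos _).le (Real.exp_pos _).le]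
      refine ENNReal.ofReal_le_ofReal ?_
      refine le_trans (le_of_eq ?_) (h1.trans (le_of_eq ?_))
      · refine Finset.sum_congr rfl fun η _ => ?_
        congr 2
        ext h
        exact Finset.sum_congr rfl fun i _ => by ring
      · refine Finset.sum_congr rfl fun η _ => Finset.sum_congr rfl fun j _ => ?_
        simp only [Finset.mul_sum, ← Finset.sum_neg_distrib]
        congr 2 <;> exact Finset.sum_congr rfl fun i _ => by ring
  refine hflip.trans ?_
  simp only [G]
  rw [lintegral_finsetSum _ fun j _ => by fun_prop]
  calc _ ≤ ∑ j : Fin d, 2 * ENNReal.ofReal (Real.exp (n * (σ ^ 2 * (R * s * L * M) ^ 2 / 2))) := by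
        refine Finset.sum_le_sum fun j _ => ?_
        rw [lintegral_add_left (by fun_prop), two_mul]
        refine add_le_add (key j _ (abs_of_nonneg (by positivity))) ?_
        have := key j (-(R * s * L)) (by rw [abs_neg]; exact abs_of_nonneg (by positivity))
        simpa only [neg_mul] using this
    _ = _ := by
        rw [Finset.sum_const, Finset.card_univ, Fintype.card_fin, nsmul_eq_mul]
        ring

/-! ### Maximal inequalities -/

/-- A tail bound valid over all finite subsets of a set is valid over the whole set. -/
lemma measure_exists_lt_le_of_finset {Ω E : Type*} [MeasurableSpace Ω] [TopologicalSpace E]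
    [TopologicalSpace.PseudoMetrizableSpace E] [SecondCountableTopology E] (P : Measure Ω)
    (S : Set E) (Φ : E → Ω → ℝ) (hΦ : ∀ z, Continuous fun h => Φ h z) (c : ℝ) {p : ℝ≥0∞}
    (hp : ∀ T : Finset E, T.Nonempty → (∀ h ∈ T, h ∈ S) → P {z | ∃ h ∈ T, c < Φ h z} ≤ p) :
    P {z | ∃ h ∈ S, c < Φ h z} ≤ p := by
  classical
  -- The strict inequality is an open condition on `h`, so it can be tested on a countable dense
  -- subset of `S`, which finite sets exhaust increasingly.
  obtain ⟨D, hDS, hDc, hSD⟩ :=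
    (TopologicalSpace.IsSeparable.of_separableSpace S).exists_countable_dense_subset
  rcases D.eq_empty_or_nonempty with rfl | hne
  · have : S = ∅ := by simpa using hSD
    simp [this]
  obtain ⟨u, rfl⟩ := hDc.exists_eq_range hne
  have hsub : {z | ∃ h ∈ S, c < Φ h z} ⊆
      ⋃ k : ℕ, {z | ∃ h ∈ (Finset.range (k + 1)).image u, c < Φ h z} := by
    rintro z ⟨h, hh, hc⟩
    obtain ⟨h', hh', k, rfl⟩ :=
      mem_closure_iff.1 (hSD hh) _ (isOpen_lt continuous_const (hΦ z)) hc
    exact Set.mem_iUnion.2 ⟨k, u k, by simpa using ⟨k, le_rfl, rfl⟩, hh'⟩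
  refine (measure_mono hsub).trans ?_
  rw [Monotone.measure_iUnion]
  · refine iSup_le fun k => hp _ (by simp) fun h hh => ?_
    obtain ⟨i, _, rfl⟩ := Finset.mem_image.1 hh
    exact hDS ⟨i, rfl⟩
  · rintro a b hab z ⟨h, hh, hc⟩
    refine ⟨h, Finset.image_subset_image (Finset.range_subset_range.2 (by lia)) hh, hc⟩

/-- Chernoff's bound for a finite supremum. -/
lemma measure_exists_lt_le_of_lintegral_exp {Ω E : Type*} [MeasurableSpace Ω] (P : Measure Ω)
    (T : Finset E) (hT : T.Nonempty) (Φ : E → Ω → ℝ) (hΦ : ∀ h, Measurable (Φ h)) (c : ℝ) {s : ℝ}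
    (hs : 0 ≤ s) {B : ℝ≥0∞}
    (hB : ∫⁻ z, ENNReal.ofReal (Real.exp (T.sup' hT fun h => s * Φ h z)) ∂P ≤ B) :
    P {z | ∃ h ∈ T, c < Φ h z} ≤ ENNReal.ofReal (Real.exp (-(s * c))) * B := by
  have hm : Measurable fun z => ENNReal.ofReal (Real.exp (T.sup' hT fun h => s * Φ h z)) :=
    (Real.measurable_exp.comp
      (measurable_sup'_real T hT fun h _ => (hΦ h).const_mul s)).ennreal_ofReal
  have h1 := mul_meas_ge_le_lintegral (μ := P) hm (ENNReal.ofReal (Real.exp (s * c)))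
  have h2 : P {z | ∃ h ∈ T, c < Φ h z} ≤ P {z | ENNReal.ofReal (Real.exp (s * c)) ≤
      ENNReal.ofReal (Real.exp (T.sup' hT fun h => s * Φ h z))} := by
    refine measure_mono ?_
    rintro z ⟨h, hh, hc⟩
    refine ENNReal.ofReal_le_ofReal (Real.exp_le_exp.2 ?_)
    exact (mul_le_mul_of_nonneg_left hc.le hs).trans (Finset.le_sup' (fun h => s * Φ h z) hh)
  calc P {z | ∃ h ∈ T, c < Φ h z}
      = ENNReal.ofReal (Real.exp (-(s * c))) *
        (ENNReal.ofReal (Real.exp (s * c)) * P {z | ∃ h ∈ T, c < Φ h z}) := by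
        rw [← mul_assoc, ← ENNReal.ofReal_mul (Real.exp_pos _).le, ← Real.exp_add]
        simp
    _ ≤ _ := by gcongr; exact ((by gcongr : _ ≤ _).trans h1).trans hB

/-- The noise process `∑ εᵢ (f (Xᵢᵀ (θ₀ + h)) - f (Xᵢᵀ θ₀))`. -/
noncomputable def noiseSum {d n : ℕ} (f : ℝ → ℝ) (θ₀ h : EuclideanSpace ℝ (Fin d))
    (z : Fin n → EuclideanSpace ℝ (Fin d) × ℝ) : ℝ :=
  ∑ i, (z i).2 * (f (inner ℝ (z i).1 (θ₀ + h)) - f (inner ℝ (z i).1 θ₀))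

lemma continuous_of_abs_sub_le {f : ℝ → ℝ} {L : ℝ} (hL : 0 ≤ L)
    (hf : ∀ s t, |f s - f t| ≤ L * |s - t|) : Continuous f :=
  (LipschitzWith.of_dist_le_mul (K := ⟨L, hL⟩) fun x y => by
    rw [Real.dist_eq, Real.dist_eq]; exact hf x y).continuous

/-- Tail bound for the noise process on an `ℓ₁` ball. -/
theorem measure_noiseSum_gt_le {d n : ℕ} (hd : 1 ≤ d) {f : ℝ → ℝ} {L : ℝ} (hL : 0 ≤ L)
    (hf : ∀ s t, |f s - f t| ≤ L * |s - t|) {σ : ℝ≥0} {ν : Measure (EuclideanSpace ℝ (Fin d))}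
    [IsProbabilityMeasure ν] {M : ℝ} (hM : ∀ᵐ x ∂ν, ∀ j, |x j| ≤ M)
    (θ₀ : EuclideanSpace ℝ (Fin d)) {R s : ℝ} (hR0 : 0 ≤ R) (hs : 0 ≤ s) (c : ℝ) :
    (Measure.pi fun _ => noiseLaw σ ν)
      {z : Fin n → EuclideanSpace ℝ (Fin d) × ℝ | ∃ h ∈ {h | l1Norm h ≤ R},
        c < noiseSum f θ₀ h z} ≤
      ENNReal.ofReal (2 * d * Real.exp (n * (σ ^ 2 * (R * s * L * M) ^ 2 / 2) - s * c)) := by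
  have hfc := continuous_of_abs_sub_le hL hf
  have hfm := hfc.measurable
  refine measure_exists_lt_le_of_finset _ _ _ (fun z => ?_) c fun T hT hTR => ?_
  · unfold noiseSum; fun_prop
  refine (measure_exists_lt_le_of_lintegral_exp _ T hT _ (fun h => ?_) c hs
    (B := 2 * d * ENNReal.ofReal (Real.exp (n * (σ ^ 2 * (R * s * L * M) ^ 2 / 2)))) ?_).trans
      (le_of_eq ?_)
  · unfold noiseSum; fun_prop
  · have := lintegral_exp_sup'_noise_le (n := n) (σ := σ) hd hL hf hM θ₀ T hT hTR hR0 hs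
    simpa only [noiseSum, Finset.mul_sum] using this
  · rw [sub_eq_add_neg, Real.exp_add, ENNReal.ofReal_mul (by positivity),
      ENNReal.ofReal_mul (by positivity), ENNReal.ofReal_mul (by positivity)]
    simp only [ENNReal.ofReal_ofNat, ENNReal.ofReal_natCast]
    ring

/-! ### The noise bound at the scale of the rate. -/

/-- The rate `√(log (4nd) / n)`. -/
noncomputable def rate (n d : ℕ) : ℝ := √(Real.log (4 * n * d) / n)

/-- The factor `4 > e` keeps the logarithm at least `1` even for `n = d = 1`, so that `1/√n` never
exceeds the rate. -/
lemma one_le_log_four_mul {n d : ℕ} (hn : 1 ≤ n) (hd : 1 ≤ d) :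
    1 ≤ Real.log (4 * n * d) := by
  have hn' : (1 : ℝ) ≤ n := by exact_mod_cast hn
  have hd' : (1 : ℝ) ≤ d := by exact_mod_cast hd
  rw [Real.le_log_iff_exp_le (by positivity)]
  have := Real.exp_one_lt_d9
  nlinarith

lemma rate_sq {n d : ℕ} (hn : 1 ≤ n) (hd : 1 ≤ d) :
    n * rate n d ^ 2 = Real.log (4 * n * d) := by
  have h1 := one_le_log_four_mul hn hd
  have hn' : (1 : ℝ) ≤ n := by exact_mod_cast hn
  rw [rate, Real.sq_sqrt (by positivity)]
  field_simp

lemma rate_pos {n d : ℕ} (hn : 1 ≤ n) (hd : 1 ≤ d) : 0 < rate n d := by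
  have h1 := one_le_log_four_mul hn hd
  have hn' : (1 : ℝ) ≤ n := by exact_mod_cast hn
  exact Real.sqrt_pos.2 (by positivity)

lemma one_le_sqrt_mul_rate {n d : ℕ} (hn : 1 ≤ n) (hd : 1 ≤ d) : 1 ≤ √n * rate n d := by
  have h1 := one_le_log_four_mul hn hd
  have hn' : (1 : ℝ) ≤ n := by exact_mod_cast hn
  rw [rate, ← Real.sqrt_mul (by positivity), mul_div_cancel₀ _ (by positivity)]
  exact Real.one_le_sqrt.2 h1

/-- Chernoff's parameter `rate / R` removes `R` from the exponent. The part `2 L² σ² M² / 4` of the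
constant cancels the variance term, and `16 / 4` leaves `-4 log (4nd)`: a fourth power, enough for a
union over order `n²` radii. -/
lemma measure_noiseSum_gt_rate_le {d n : ℕ} (hn : 1 ≤ n) (hd : 1 ≤ d) {f : ℝ → ℝ} {L : ℝ}
    (hL : 0 ≤ L) (hf : ∀ s t, |f s - f t| ≤ L * |s - t|) {σ : ℝ≥0}
    {ν : Measure (EuclideanSpace ℝ (Fin d))} [IsProbabilityMeasure ν] {M : ℝ}
    (hM : ∀ᵐ x ∂ν, ∀ j, |x j| ≤ M) (θ₀ : EuclideanSpace ℝ (Fin d)) {R : ℝ} (hR0 : 0 < R) :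
    (Measure.pi fun _ => noiseLaw σ ν)
      {z : Fin n → EuclideanSpace ℝ (Fin d) × ℝ | ∃ h ∈ {h | l1Norm h ≤ R},
        (2 * L ^ 2 * σ ^ 2 * M ^ 2 + 16) / 4 * (n * rate n d * R) < noiseSum f θ₀ h z} ≤
      ENNReal.ofReal (2 * d * ((4 * n * d : ℝ) ^ 4)⁻¹) := by
  have hr := rate_pos hn hd
  refine (measure_noiseSum_gt_le hd hL hf hM θ₀ hR0.le (s := rate n d / R)
    (by positivity) _).trans (ENNReal.ofReal_le_ofReal ?_)
  have hpos : (0 : ℝ) < 4 * n * d := by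
    have : (0 : ℝ) < n := by exact_mod_cast hn
    have : (0 : ℝ) < d := by exact_mod_cast hd
    positivity
  have e : n * (σ ^ 2 * (R * (rate n d / R) * L * M) ^ 2 / 2) -
      rate n d / R * ((2 * L ^ 2 * σ ^ 2 * M ^ 2 + 16) / 4 * (n * rate n d * R)) =
      -((4 : ℕ) * Real.log (4 * n * d)) := by
    rw [← rate_sq hn hd]
    field_simp
    push_cast
    ring
  rw [e, Real.exp_neg, Real.exp_nat_mul, Real.exp_log hpos]

/-- Since `-f` has the same Lipschitz constant, the upper tail bound also yields the lower one. -/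
lemma noiseSum_neg {d n : ℕ} (f : ℝ → ℝ) (θ₀ h : EuclideanSpace ℝ (Fin d))
    (z : Fin n → EuclideanSpace ℝ (Fin d) × ℝ) :
    noiseSum (fun t => -f t) θ₀ h z = -noiseSum f θ₀ h z := by
  simp only [noiseSum, ← Finset.sum_neg_distrib]
  exact Finset.sum_congr rfl fun i _ => by ring

/-- Boundedness of `f` controls the noise where `|h|₁` is too large for the peeling. -/
lemma abs_noiseSum_le {d n : ℕ} {f : ℝ → ℝ} {B : ℝ} (hB : ∀ t, |f t| ≤ B)
    (θ₀ h : EuclideanSpace ℝ (Fin d)) (z : Fin n → EuclideanSpace ℝ (Fin d) × ℝ) :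
    |noiseSum f θ₀ h z| ≤ 2 * B * ∑ i, |(z i).2| := by
  rw [Finset.mul_sum]
  refine (Finset.abs_sum_le_sum_abs _ _).trans (Finset.sum_le_sum fun i _ => ?_)
  rw [abs_mul, mul_comm]
  refine mul_le_mul_of_nonneg_right ?_ (abs_nonneg _)
  have h1 := abs_le.1 (hB (inner ℝ (z i).1 (θ₀ + h)))
  have h2 := abs_le.1 (hB (inner ℝ (z i).1 θ₀))
  rw [abs_le]
  constructor <;> linarith [h1.1, h1.2, h2.1, h2.2]

lemma integrable_abs_gaussianReal (v : ℝ≥0) :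
    Integrable (fun x : ℝ => |x|) (gaussianReal 0 v) := by
  have := (memLp_id_gaussianReal (μ := 0) (v := v) 1).integrable (by simp)
  exact this.abs

/-- Markov's inequality. The threshold is generous, because it is compared with `n * rate * |h|₁`
only when `|h|₁ ≥ B n`. -/
lemma measure_sum_abs_noise_gt_le {d n : ℕ} (hn : 1 ≤ n) {σ : ℝ≥0}
    {ν : Measure (EuclideanSpace ℝ (Fin d))} [IsProbabilityMeasure ν] :
    (Measure.pi fun _ => noiseLaw σ ν)
      {z : Fin n → EuclideanSpace ℝ (Fin d) × ℝ | n * √n < ∑ i, |(z i).2|} ≤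
      ENNReal.ofReal ((∫ x, |x| ∂(gaussianReal 0 (σ ^ 2))) / √n) := by
  have hn' : (0 : ℝ) < n := by exact_mod_cast hn
  set A := ∫ x, |x| ∂(gaussianReal 0 (σ ^ 2))
  have h0 : ∫⁻ x, ENNReal.ofReal |x| ∂(gaussianReal 0 (σ ^ 2)) = ENNReal.ofReal A :=
    (ofReal_integral_eq_lintegral_ofReal (integrable_abs_gaussianReal _)
      (ae_of_all _ fun x => abs_nonneg x)).symm
  have h1 : ∫⁻ z : Fin n → EuclideanSpace ℝ (Fin d) × ℝ, ENNReal.ofReal (∑ i, |(z i).2|)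
      ∂(Measure.pi fun _ => noiseLaw σ ν) = ENNReal.ofReal (n * A) := by
    simp only [fun z : Fin n → EuclideanSpace ℝ (Fin d) × ℝ =>
      ENNReal.ofReal_sum_of_nonneg (s := Finset.univ) fun i _ => abs_nonneg (z i).2]
    rw [lintegral_finsetSum _ fun i _ => by fun_prop]
    have : ∀ i : Fin n, ∫⁻ z : Fin n → EuclideanSpace ℝ (Fin d) × ℝ, ENNReal.ofReal |(z i).2|
        ∂(Measure.pi fun _ => noiseLaw σ ν) = ENNReal.ofReal A := by
      intro i
      rw [← h0, (measurePreserving_eval (fun _ : Fin n => noiseLaw σ ν) i).lintegral_comp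
        (f := fun w : EuclideanSpace ℝ (Fin d) × ℝ => ENNReal.ofReal |w.2|) (by fun_prop)]
      exact (measurePreserving_snd (μ := ν) (ν := gaussianReal 0 (σ ^ 2))).lintegral_comp
        (f := fun x : ℝ => ENNReal.ofReal |x|) (by fun_prop)
    simp [this, ENNReal.ofReal_mul]
  have h2 := meas_ge_le_lintegral_div (μ := Measure.pi fun _ : Fin n => noiseLaw σ ν)
    (f := fun z : Fin n → EuclideanSpace ℝ (Fin d) × ℝ => ENNReal.ofReal (∑ i, |(z i).2|))
    (Measurable.aemeasurable (by fun_prop)) (ε := ENNReal.ofReal (n * √n))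
    (by have : 0 < n * √(n : ℝ) := by positivity
        exact (ENNReal.ofReal_pos.2 this).ne') (by finiteness)
  rw [h1, ← ENNReal.ofReal_div_of_pos (by positivity)] at h2
  refine (measure_mono fun z hz => ?_).trans (h2.trans (ENNReal.ofReal_le_ofReal (le_of_eq ?_)))
  · exact ENNReal.ofReal_le_ofReal (le_of_lt hz)
  · field_simp

/-- With high probability the noise process is dominated by the `ℓ₁` norm. -/
theorem measure_noise_event_le {d n : ℕ} (hn : 1 ≤ n) (hd : 1 ≤ d) {f : ℝ → ℝ} {L B : ℝ}
    (hL : 0 ≤ L) (hf : ∀ s t, |f s - f t| ≤ L * |s - t|) (hB : ∀ t, |f t| ≤ B) {σ : ℝ≥0}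
    {ν : Measure (EuclideanSpace ℝ (Fin d))} [IsProbabilityMeasure ν] {M : ℝ}
    (hM : ∀ᵐ x ∂ν, ∀ j, |x j| ≤ M) (θ₀ : EuclideanSpace ℝ (Fin d)) :
    (Measure.pi fun _ => noiseLaw σ ν)
      {z : Fin n → EuclideanSpace ℝ (Fin d) × ℝ | ∃ h,
        (2 * L ^ 2 * σ ^ 2 * M ^ 2 + 16) / 4 * (n * rate n d * (l1Norm h + 1 / n)) <
          |noiseSum f θ₀ h z|} ≤
      ENNReal.ofReal (((∫ x, |x| ∂(gaussianReal 0 (σ ^ 2))) + (B + 2)) / √n) := by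
  have hn1 : (1 : ℝ) ≤ n := by exact_mod_cast hn
  have hd1 : (1 : ℝ) ≤ d := by exact_mod_cast hd
  have hr := rate_pos hn hd
  have hr1 := one_le_sqrt_mul_rate hn hd
  have hB0 : 0 ≤ B := (abs_nonneg _).trans (hB 0)
  set K := 2 * L ^ 2 * σ ^ 2 * M ^ 2 + 16 with hK
  have hK16 : 16 ≤ K := by
    have : 0 ≤ 2 * L ^ 2 * (σ : ℝ) ^ 2 * M ^ 2 := by positivity
    linarith
  set P := Measure.pi fun _ : Fin n => noiseLaw σ ν
  -- The radii `(m + 1) / n` with `m < N` cover `|h|₁` up to about `B n`. Rounding `|h|₁` up to this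
  -- grid costs at most the slack `1 / n`.
  set N : ℕ := ⌈B⌉₊ * n ^ 2 + 1 with hN
  let A : (ℝ → ℝ) → ℕ → Set (Fin n → EuclideanSpace ℝ (Fin d) × ℝ) := fun g m =>
    {z | ∃ h ∈ {h | l1Norm h ≤ (m + 1) / n},
      K / 4 * (n * rate n d * ((m + 1) / n)) < noiseSum g θ₀ h z}
  have hA : ∀ m, P (A f m) ≤ ENNReal.ofReal (2 * d * ((4 * n * d : ℝ) ^ 4)⁻¹) := fun m =>
    measure_noiseSum_gt_rate_le hn hd hL hf hM θ₀ (by positivity)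
  have hA' : ∀ m, P (A (fun t => -f t) m) ≤ ENNReal.ofReal (2 * d * ((4 * n * d : ℝ) ^ 4)⁻¹) :=
    fun m => measure_noiseSum_gt_rate_le hn hd hL (fun s t => by
      rw [neg_sub_neg, abs_sub_comm]; exact hf s t) hM θ₀ (by positivity)
  have hsub : {z : Fin n → EuclideanSpace ℝ (Fin d) × ℝ | ∃ h,
      K / 4 * (n * rate n d * (l1Norm h + 1 / n)) < |noiseSum f θ₀ h z|} ⊆
      {z | n * √n < ∑ i, |(z i).2|} ∪
        ⋃ m ∈ Finset.range N, (A f m ∪ A (fun t => -f t) m) := by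
    rintro z ⟨h, hh⟩
    by_cases hz : n * √n < ∑ i, |(z i).2|
    · exact Or.inl hz
    right
    push Not at hz
    have hh0 := l1Norm_nonneg h
    set m := ⌊n * l1Norm h⌋₊ with hm
    have hm1 : (m : ℝ) ≤ n * l1Norm h := Nat.floor_le (by positivity)
    have hm2 : n * l1Norm h < m + 1 := Nat.lt_floor_add_one _
    have hmN : m < N := by
      by_contra hcon
      push Not at hcon
      have h1 : (N : ℝ) ≤ n * l1Norm h := le_trans (by exact_mod_cast hcon) hm1
      -- Beyond the grid, the noise is at most `2 B n √n`, while `n * rate ≥ √n` and `K / 4 ≥ 4`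
      -- make the claimed bound larger.
      have h2 : B * n ^ 2 ≤ n * l1Norm h := by
        refine le_trans ?_ h1
        rw [hN]
        push_cast
        nlinarith [Nat.le_ceil B, sq_nonneg (n : ℝ)]
      have h3 := abs_noiseSum_le hB θ₀ h z
      have h4 : 2 * B * ∑ i, |(z i).2| ≤ 2 * B * (n * √n) :=
        mul_le_mul_of_nonneg_left hz (by positivity)
      have hB1 : B * n ≤ l1Norm h := by nlinarith
      have hs : √(n : ℝ) * √n = n := Real.mul_self_sqrt (by positivity)
      have hr2 : √(n : ℝ) ≤ n * rate n d := by
        nlinarith [Real.sqrt_nonneg (n : ℝ)]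
      have h5 : √n * (B * n) ≤ n * rate n d * l1Norm h :=
        mul_le_mul hr2 hB1 (by positivity) (by positivity)
      have h6 : n * rate n d * l1Norm h ≤ n * rate n d * (l1Norm h + 1 / n) := by
        gcongr; simp
      have h7 : 0 ≤ n * rate n d * (l1Norm h + 1 / n) := by positivity
      have h8 : 0 ≤ √n * (B * n) := by positivity
      nlinarith
    have hle : K / 4 * (n * rate n d * ((m + 1) / n)) <
        |noiseSum f θ₀ h z| := by
      refine lt_of_le_of_lt ?_ hh
      gcongr
      rw [div_le_iff₀ (by positivity), add_mul, div_mul_cancel₀ _ (by positivity)]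
      linarith
    have hmem : l1Norm h ≤ (m + 1) / n := by
      rw [le_div_iff₀ (by positivity)]; linarith
    refine Set.mem_biUnion (Finset.mem_coe.2 (Finset.mem_range.2 hmN)) ?_
    rcases lt_abs.1 hle with h1 | h1
    · exact Or.inl ⟨h, hmem, h1⟩
    · exact Or.inr ⟨h, hmem, by rwa [noiseSum_neg]⟩
  refine (measure_mono hsub).trans ((measure_union_le _ _).trans ?_)
  rw [add_div, ENNReal.ofReal_add (by positivity) (by positivity)]
  refine add_le_add (measure_sum_abs_noise_gt_le hn) ?_
  refine (measure_biUnion_finset_le _ _).trans ?_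
  calc ∑ m ∈ Finset.range N, P (A f m ∪ A (fun t => -f t) m)
      ≤ ∑ m ∈ Finset.range N, ENNReal.ofReal (4 * d * ((4 * n * d : ℝ) ^ 4)⁻¹) := by
        refine Finset.sum_le_sum fun m _ => (measure_union_le _ _).trans
          ((add_le_add (hA m) (hA' m)).trans (le_of_eq ?_))
        rw [← ENNReal.ofReal_add (by positivity) (by positivity)]
        congr 1; ring
    _ = ENNReal.ofReal (N * (4 * d * ((4 * n * d : ℝ) ^ 4)⁻¹)) := by
        rw [Finset.sum_const, Finset.card_range, nsmul_eq_mul,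
          ENNReal.ofReal_mul N.cast_nonneg, ENNReal.ofReal_natCast]
    _ ≤ _ := by
        refine ENNReal.ofReal_le_ofReal ?_
        have hNle : (N : ℝ) ≤ (B + 2) * n ^ 2 := by
          rw [hN]
          push_cast
          nlinarith [Nat.ceil_lt_add_one hB0, one_le_pow₀ hn1 (n := 2)]
        have h1 : 4 * d * ((4 * n * d : ℝ) ^ 4)⁻¹ ≤ 1 / (n : ℝ) ^ 4 := by
          rw [← div_eq_mul_inv, div_le_div_iff₀ (by positivity) (by positivity)]
          have : (d : ℝ) ≤ d ^ 4 := le_self_pow₀ hd1 (by norm_num)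
          nlinarith [mul_le_mul_of_nonneg_right this (by positivity : 0 ≤ (n : ℝ) ^ 4),
            (by positivity : 0 ≤ (n : ℝ) ^ 4 * (d : ℝ) ^ 4)]
        have h2 : √(n : ℝ) ≤ n := Real.sqrt_le_iff.2 ⟨by positivity, by nlinarith⟩
        calc N * (4 * d * ((4 * n * d : ℝ) ^ 4)⁻¹) ≤ (B + 2) * n ^ 2 * (1 / (n : ℝ) ^ 4) := by
              gcongr
          _ = (B + 2) / (n : ℝ) ^ 2 := by field_simp
          _ ≤ (B + 2) / √n := by
              gcongr
              nlinarith

/-! ### The truncated quadratic process -/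

/-- The truncated square `1{|xᵀθ₀| ≤ τ} min((xᵀh)², τ²)`. -/
noncomputable def truncSq {d : ℕ} (τ : ℝ) (θ₀ h x : EuclideanSpace ℝ (Fin d)) : ℝ :=
  if |inner ℝ x θ₀| ≤ τ then min (inner ℝ x h ^ 2) (τ ^ 2) else 0

section truncSq

variable {d : ℕ} {τ : ℝ} (θ₀ : EuclideanSpace ℝ (Fin d))

lemma truncSq_nonneg (h x : EuclideanSpace ℝ (Fin d)) : 0 ≤ truncSq τ θ₀ h x := by
  unfold truncSq
  split_ifs <;> positivity

lemma truncSq_le (h x : EuclideanSpace ℝ (Fin d)) : truncSq τ θ₀ h x ≤ τ ^ 2 := by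
  unfold truncSq
  split_ifs
  · exact min_le_right _ _
  · positivity

lemma continuous_truncSq (x : EuclideanSpace ℝ (Fin d)) :
    Continuous fun h => truncSq τ θ₀ h x := by
  unfold truncSq
  split_ifs <;> fun_prop

lemma measurable_truncSq (h : EuclideanSpace ℝ (Fin d)) :
    Measurable fun x => truncSq τ θ₀ h x := by
  unfold truncSq
  refine Measurable.ite ?_ (by fun_prop) measurable_const
  exact measurableSet_le (by fun_prop) measurable_const

/-- The capped square is the square of `min |u| τ`, which is 1-Lipschitz and at most `τ`. This makes
contraction available for the quadratic process. -/
lemma abs_min_sq_sub_min_sq_le (hτ : 0 ≤ τ) (u v : ℝ) :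
    |min (u ^ 2) (τ ^ 2) - min (v ^ 2) (τ ^ 2)| ≤ 2 * τ * |u - v| := by
  have e : ∀ u : ℝ, min (u ^ 2) (τ ^ 2) = min |u| τ ^ 2 := by
    intro u
    rcases le_total |u| τ with h | h
    · rw [min_eq_left h, sq_abs, min_eq_left]
      rw [← sq_abs]; gcongr
    · rw [min_eq_right h, min_eq_right]
      rw [← sq_abs u]; gcongr
  rw [e, e, sq_sub_sq, abs_mul]
  have h1 : |min |u| τ - min |v| τ| ≤ |u - v| :=
    (abs_inf_sub_inf_le_abs |u| |v| τ).trans (abs_abs_sub_abs_le_abs_sub u v)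
  have h2 : |min |u| τ + min |v| τ| ≤ 2 * τ := by
    have h3 : 0 ≤ min |u| τ := le_min (abs_nonneg _) hτ
    have h4 : 0 ≤ min |v| τ := le_min (abs_nonneg _) hτ
    rw [abs_of_nonneg (by positivity)]
    linarith [min_le_right |u| τ, min_le_right |v| τ]
  exact mul_le_mul h2 h1 (abs_nonneg _) (by positivity)

lemma abs_truncSq_sub_le (hτ : 0 ≤ τ) (h k x : EuclideanSpace ℝ (Fin d)) :
    |truncSq τ θ₀ h x - truncSq τ θ₀ k x| ≤ 2 * τ * |inner ℝ x h - inner ℝ x k| := by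
  unfold truncSq
  split_ifs
  · exact abs_min_sq_sub_min_sq_le hτ _ _
  · simp only [sub_self, abs_zero]; positivity

lemma abs_truncSq_le (hτ : 0 ≤ τ) (h x : EuclideanSpace ℝ (Fin d)) :
    |truncSq τ θ₀ h x| ≤ 2 * τ * |inner ℝ x h| := by
  have := abs_truncSq_sub_le θ₀ hτ h 0 x
  have h0 : truncSq τ θ₀ 0 x = 0 := by
    unfold truncSq
    simp [sq_nonneg]
  simpa [h0] using this

lemma integrable_truncSq (ν : Measure (EuclideanSpace ℝ (Fin d))) [IsProbabilityMeasure ν]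
    (h : EuclideanSpace ℝ (Fin d)) : Integrable (fun x => truncSq τ θ₀ h x) ν :=
  Integrable.of_bound (C := τ ^ 2) (measurable_truncSq θ₀ h).aestronglyMeasurable
    (ae_of_all _ fun x => by
      rw [Real.norm_eq_abs, abs_of_nonneg (truncSq_nonneg θ₀ h x)]
      exact truncSq_le θ₀ h x)

end truncSq

/-- Hoeffding's bound for Rademacher sums, from `cosh y ≤ exp (y² / 2)` one sign at a time. -/
lemma sum_exp_boolSign_le {n : ℕ} (y : Fin n → ℝ) {a : ℝ} (hy : ∀ i, |y i| ≤ a) :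
    ∑ η : Fin n → Bool, Real.exp (∑ i, boolSign (η i) * y i) ≤
      2 ^ n * Real.exp (n * (a ^ 2 / 2)) := by
  induction n with
  | zero => simp
  | succ n ih =>
    rw [sum_fin_succ_bool]
    simp only [Fin.sum_univ_succ, Fin.cons_zero, Fin.cons_succ, boolSign_true, boolSign_false,
      one_mul, neg_mul, Real.exp_add, ← add_mul, ← Finset.mul_sum]
    have h1 : Real.exp (y 0) + Real.exp (-y 0) ≤ 2 * Real.exp (a ^ 2 / 2) := by
      have h2 := Real.cosh_le_exp_half_sq (y 0)
      rw [Real.cosh_eq] at h2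
      have h3 : Real.exp (y 0 ^ 2 / 2) ≤ Real.exp (a ^ 2 / 2) := by
        have : y 0 ^ 2 ≤ a ^ 2 := by
          rw [← sq_abs]; exact pow_le_pow_left₀ (abs_nonneg _) (hy 0) 2
        gcongr
      linarith
    calc _ ≤ (2 * Real.exp (a ^ 2 / 2)) * (2 ^ n * Real.exp (n * (a ^ 2 / 2))) :=
          mul_le_mul h1 (ih _ fun i => hy i.succ) (by positivity) (by positivity)
      _ = _ := by
          rw [pow_succ]
          push_cast
          rw [add_mul, Real.exp_add, one_mul]
          ring

/-- A bound on the average over sign flips bounds the integral. -/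
lemma lintegral_le_of_sum_flipCoords_le_const {𝒳 : Type*} [MeasurableSpace 𝒳] {n : ℕ}
    {Q : Measure 𝒳} [IsProbabilityMeasure Q] {ι : 𝒳 → 𝒳} (hι : MeasurePreserving ι Q Q)
    {F : (Fin n → 𝒳) → ℝ≥0∞} (hF : Measurable F) {C : ℝ≥0∞}
    (h : ∀ᵐ x ∂(Measure.pi fun _ : Fin n => Q),
      ∑ η : Fin n → Bool, F (flipCoords ι η x) ≤ 2 ^ n * C) :
    ∫⁻ x, F x ∂(Measure.pi fun _ => Q) ≤ C := by
  have h1 : (2 : ℝ≥0∞) ^ n * ∫⁻ x, F x ∂(Measure.pi fun _ => Q) ≤ 2 ^ n * C := by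
    rw [← sum_lintegral_flipCoords hι hF]
    refine (lintegral_mono_ae h).trans ?_
    simp
  exact (ENNReal.mul_le_mul_iff_right (by simp) (by finiteness)).1 h1

/-- Decouples the sample and its ghost copy, by `e^(A+B) ≤ (e^(2A) + e^(2B)) / 2`, at the cost of
doubling the scale. -/
lemma exp_sup'_add_le {ι : Type*} (T : Finset ι) (hT : T.Nonempty) (A B : ι → ℝ) :
    Real.exp (T.sup' hT fun t => A t + B t) ≤
      (Real.exp (T.sup' hT fun t => 2 * A t) + Real.exp (T.sup' hT fun t => 2 * B t)) / 2 := by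
  obtain ⟨t, ht, hte⟩ := Finset.exists_mem_eq_sup' hT fun t => A t + B t
  rw [hte]
  have h1 : Real.exp (2 * A t) ≤ Real.exp (T.sup' hT fun t => 2 * A t) :=
    Real.exp_le_exp.2 (Finset.le_sup' (fun t => 2 * A t) ht)
  have h2 : Real.exp (2 * B t) ≤ Real.exp (T.sup' hT fun t => 2 * B t) :=
    Real.exp_le_exp.2 (Finset.le_sup' (fun t => 2 * B t) ht)
  have h3 : Real.exp (A t + B t) ≤ (Real.exp (2 * A t) + Real.exp (2 * B t)) / 2 := by
    rw [Real.exp_add, two_mul, two_mul, Real.exp_add, Real.exp_add]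
    nlinarith [sq_nonneg (Real.exp (A t) - Real.exp (B t))]
  linarith

section Design

variable {d n : ℕ} {τ : ℝ} (θ₀ : EuclideanSpace ℝ (Fin d))

/-- Contraction with Lipschitz constant `2 |s| τ`, then Hoeffding with the design held fixed. Both
signs of `s` occur, for the sample and for its ghost copy. -/
lemma sum_exp_sup'_truncSq_le (hd : 1 ≤ d) (hτ : 0 ≤ τ) (T : Finset (EuclideanSpace ℝ (Fin d)))
    (hT : T.Nonempty) {R s M : ℝ} (hR : ∀ h ∈ T, l1Norm h ≤ R) (hR0 : 0 ≤ R)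
    (x : Fin n → EuclideanSpace ℝ (Fin d)) (hx : ∀ i j, |x i j| ≤ M) :
    ∑ η : Fin n → Bool, Real.exp (T.sup' hT fun h =>
      ∑ i, boolSign (η i) * (s * truncSq τ θ₀ h (x i))) ≤
      2 ^ n * (2 * d * Real.exp (n * ((R * (2 * |s| * τ) * M) ^ 2 / 2))) := by
  have h1 := sum_exp_sup'_le_sum_coord hd T hT (fun h i => s * truncSq τ θ₀ h (x i)) x
    (fun _ => 2 * |s| * τ) hR
    (fun i h _ k _ => by
      rw [← mul_sub, abs_mul, abs_mul, abs_of_nonneg (by positivity : 0 ≤ 2 * |s| * τ)]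
      have := mul_le_mul_of_nonneg_left (abs_truncSq_sub_le θ₀ hτ h k (x i)) (abs_nonneg s)
      linarith)
    (fun i h _ => by
      rw [abs_mul, abs_mul, abs_of_nonneg (by positivity : 0 ≤ 2 * |s| * τ)]
      have := mul_le_mul_of_nonneg_left (abs_truncSq_le θ₀ hτ h (x i)) (abs_nonneg s)
      linarith)
  refine h1.trans ?_
  rw [Finset.sum_comm]
  have key : ∀ j : Fin d, ∀ c : ℝ, |c| = R * (2 * |s| * τ) →
      ∑ η : Fin n → Bool, Real.exp (∑ i, boolSign (η i) * (c * x i j)) ≤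
        2 ^ n * Real.exp (n * ((R * (2 * |s| * τ) * M) ^ 2 / 2)) := fun j c hc =>
    sum_exp_boolSign_le _ fun i => by
      rw [abs_mul, hc]
      exact mul_le_mul_of_nonneg_left (hx i j) (by positivity)
  calc _ ≤ ∑ j : Fin d, 2 * (2 ^ n * Real.exp (n * ((R * (2 * |s| * τ) * M) ^ 2 / 2))) := by
        refine Finset.sum_le_sum fun j _ => ?_
        rw [Finset.sum_add_distrib, two_mul (2 ^ n * _)]
        refine add_le_add (le_trans (le_of_eq ?_) (key j _ (abs_of_nonneg (by positivity))))
          (le_trans (le_of_eq ?_) (key j (-(R * (2 * |s| * τ)))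
            (by rw [abs_neg]; exact abs_of_nonneg (by positivity))))
        all_goals
          refine Finset.sum_congr rfl fun η _ => ?_
          simp only [Finset.mul_sum, ← Finset.sum_neg_distrib]
          congr 1
          exact Finset.sum_congr rfl fun i _ => by ring
    _ = _ := by
        rw [Finset.sum_const, Finset.card_univ, Fintype.card_fin, nsmul_eq_mul]
        ring

/-- Exponential moment of the symmetrized truncated quadratic process. -/
lemma lintegral_exp_sup'_truncSq_sub_le (hd : 1 ≤ d) (hτ : 0 ≤ τ)
    {ν : Measure (EuclideanSpace ℝ (Fin d))} [IsProbabilityMeasure ν] {M : ℝ}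
    (hM : ∀ᵐ x ∂ν, ∀ j, |x j| ≤ M) (T : Finset (EuclideanSpace ℝ (Fin d)))
    (hT : T.Nonempty) {R s : ℝ} (hR : ∀ h ∈ T, l1Norm h ≤ R) (hR0 : 0 ≤ R) (hs : 0 ≤ s) :
    ∫⁻ w, ENNReal.ofReal (Real.exp (T.sup' hT fun h => ∑ i : Fin n,
        s * (truncSq τ θ₀ h (w i).2 - truncSq τ θ₀ h (w i).1)))
        ∂(Measure.pi fun _ => ν.prod ν) ≤
      ENNReal.ofReal (2 * d * Real.exp (n * ((4 * R * s * τ * M) ^ 2 / 2))) := by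
  -- Exchanging an observation with its ghost copy preserves the law and reverses the sign of the
  -- difference.
  have hswap : MeasurePreserving Prod.swap (ν.prod ν) (ν.prod ν) := Measure.measurePreserving_swap
  have hM2 : ∀ᵐ w ∂(Measure.pi fun _ : Fin n => ν.prod ν),
      ∀ i, (∀ j, |(w i).1 j| ≤ M) ∧ ∀ j, |(w i).2 j| ≤ M := by
    refine ae_all_iff.2 fun i => ?_
    have h1 : ∀ᵐ z ∂(ν.prod ν), (∀ j, |z.1 j| ≤ M) ∧ ∀ j, |z.2 j| ≤ M :=
      (Measure.quasiMeasurePreserving_fst.ae hM).and (Measure.quasiMeasurePreserving_snd.ae hM)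
    exact (measurePreserving_eval (fun _ : Fin n => ν.prod ν) i).quasiMeasurePreserving.ae h1
  have hmeas := fun h => measurable_truncSq (τ := τ) θ₀ h
  refine lintegral_le_of_sum_flipCoords_le_const hswap ?_ ?_
  · refine (Real.measurable_exp.comp (measurable_sup'_real T hT fun h _ => ?_)).ennreal_ofReal
    fun_prop
  filter_upwards [hM2] with w hw
  rw [← ENNReal.ofReal_sum_of_nonneg fun _ _ => (Real.exp_pos _).le]
  have e2 : (2 : ℝ≥0∞) ^ n = ENNReal.ofReal (2 ^ n) := by
    rw [ENNReal.ofReal_pow (by norm_num)]; simp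
  rw [e2, ← ENNReal.ofReal_mul (by positivity)]
  refine ENNReal.ofReal_le_ofReal ?_
  have e1 : ∀ η : Fin n → Bool, ∀ h i,
      s * (truncSq τ θ₀ h (flipCoords Prod.swap η w i).2 -
        truncSq τ θ₀ h (flipCoords Prod.swap η w i).1) =
      boolSign (η i) * (s * truncSq τ θ₀ h (w i).2) +
        boolSign (η i) * (-s * truncSq τ θ₀ h (w i).1) := by
    intro η h i
    unfold flipCoords
    cases η i <;> simp <;> ring
  simp only [e1, Finset.sum_add_distrib]
  have hA := sum_exp_sup'_truncSq_le θ₀ hd hτ T hT (s := 2 * s) hR hR0 (fun i => (w i).2)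
    fun i => (hw i).2
  have hB := sum_exp_sup'_truncSq_le θ₀ hd hτ T hT (s := -(2 * s)) hR hR0 (fun i => (w i).1)
    fun i => (hw i).1
  rw [abs_neg] at hB
  rw [abs_of_nonneg (by positivity)] at hA hB
  have e3 : R * (2 * (2 * s) * τ) * M = 4 * R * s * τ * M := by ring
  rw [e3] at hA hB
  refine (Finset.sum_le_sum fun η _ => exp_sup'_add_le T hT _ _).trans ?_
  rw [← Finset.sum_div, Finset.sum_add_distrib]
  have hA' : ∀ η : Fin n → Bool, (fun h => 2 * ∑ i, boolSign (η i) * (s * truncSq τ θ₀ h (w i).2)) =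
      fun h => ∑ i, boolSign (η i) * (2 * s * truncSq τ θ₀ h (w i).2) := by
    intro η; ext h
    rw [Finset.mul_sum]
    exact Finset.sum_congr rfl fun i _ => by ring
  have hB' : ∀ η : Fin n → Bool,
      (fun h => 2 * ∑ i, boolSign (η i) * (-s * truncSq τ θ₀ h (w i).1)) =
      fun h => ∑ i, boolSign (η i) * (-(2 * s) * truncSq τ θ₀ h (w i).1) := by
    intro η; ext h
    rw [Finset.mul_sum]
    exact Finset.sum_congr rfl fun i _ => by ring
  simp only [hA', hB']
  linarith

/-- Exponential moment of the centred truncated quadratic process. -/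
lemma lintegral_exp_sup'_centred_truncSq_le (hd : 1 ≤ d) (hτ : 0 ≤ τ)
    {ν : Measure (EuclideanSpace ℝ (Fin d))} [IsProbabilityMeasure ν] {M : ℝ}
    (hM : ∀ᵐ x ∂ν, ∀ j, |x j| ≤ M) (T : Finset (EuclideanSpace ℝ (Fin d)))
    (hT : T.Nonempty) {R s : ℝ} (hR : ∀ h ∈ T, l1Norm h ≤ R) (hR0 : 0 ≤ R) (hs : 0 ≤ s) :
    ∫⁻ x, ENNReal.ofReal (Real.exp (T.sup' hT fun h => s * ∑ i : Fin n,
        ((∫ y, truncSq τ θ₀ h y ∂ν) - truncSq τ θ₀ h (x i)))) ∂(Measure.pi fun _ => ν) ≤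
      ENNReal.ofReal (2 * d * Real.exp (n * ((4 * R * s * τ * M) ^ 2 / 2))) := by
  have hmeas := fun h => measurable_truncSq (τ := τ) θ₀ h
  let F : (Fin n → EuclideanSpace ℝ (Fin d)) × (Fin n → EuclideanSpace ℝ (Fin d)) → ℝ := fun w =>
    T.sup' hT fun h => ∑ i : Fin n, s * (truncSq τ θ₀ h (w.2 i) - truncSq τ θ₀ h (w.1 i))
  have hF : Measurable F := measurable_sup'_real T hT fun h _ => by fun_prop
  have hterm : ∀ h, ∀ x y : EuclideanSpace ℝ (Fin d),
      |s * (truncSq τ θ₀ h y - truncSq τ θ₀ h x)| ≤ s * τ ^ 2 := by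
    intro h x y
    rw [abs_mul, abs_of_nonneg hs]
    refine mul_le_mul_of_nonneg_left ?_ hs
    rw [abs_le]
    constructor <;> linarith [truncSq_nonneg (τ := τ) θ₀ h x, truncSq_nonneg (τ := τ) θ₀ h y,
      truncSq_le (τ := τ) θ₀ h x, truncSq_le (τ := τ) θ₀ h y]
  have hFle : ∀ w, F w ≤ n * (s * τ ^ 2) := by
    intro w
    refine Finset.sup'_le _ _ fun h _ => ?_
    refine (Finset.sum_le_sum fun i _ => (le_abs_self _).trans (hterm h (w.1 i) (w.2 i))).trans ?_
    simp
  -- Jensen's inequality: the population mean is the expectation over a ghost sample `y`, which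
  -- moves outside the exponential at the maximizing `h`.
  have hpoint : ∀ x : Fin n → EuclideanSpace ℝ (Fin d),
      ENNReal.ofReal (Real.exp (T.sup' hT fun h => s * ∑ i : Fin n,
        ((∫ y, truncSq τ θ₀ h y ∂ν) - truncSq τ θ₀ h (x i)))) ≤
      ∫⁻ y, ENNReal.ofReal (Real.exp (F (x, y))) ∂(Measure.pi fun _ => ν) := by
    intro x
    have hint : Integrable (fun y => Real.exp (F (x, y))) (Measure.pi fun _ => ν) := by
      refine Integrable.of_bound (C := Real.exp (n * (s * τ ^ 2)))
        (Measurable.aestronglyMeasurable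
          (Real.measurable_exp.comp (hF.comp measurable_prodMk_left)))
        (ae_of_all _ fun y => ?_)
      rw [Real.norm_eq_abs, abs_of_pos (Real.exp_pos _)]
      exact Real.exp_le_exp.2 (hFle _)
    rw [← ofReal_integral_eq_lintegral_ofReal hint (ae_of_all _ fun y => (Real.exp_pos _).le)]
    refine ENNReal.ofReal_le_ofReal ?_
    obtain ⟨h, hh, he⟩ := Finset.exists_mem_eq_sup' hT fun h => s * ∑ i : Fin n,
        ((∫ y, truncSq τ θ₀ h y ∂ν) - truncSq τ θ₀ h (x i))
    rw [he]
    let g : (Fin n → EuclideanSpace ℝ (Fin d)) → ℝ := fun y =>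
      ∑ i : Fin n, s * (truncSq τ θ₀ h (y i) - truncSq τ θ₀ h (x i))
    have hev : ∀ i : Fin n, Integrable (fun y : Fin n → EuclideanSpace ℝ (Fin d) =>
        truncSq τ θ₀ h (y i)) (Measure.pi fun _ => ν) := fun i =>
      (measurePreserving_eval (fun _ : Fin n => ν) i).integrable_comp_of_integrable
        (integrable_truncSq θ₀ ν h)
    have hgi : ∀ i : Fin n, Integrable (fun y : Fin n → EuclideanSpace ℝ (Fin d) =>
        s * (truncSq τ θ₀ h (y i) - truncSq τ θ₀ h (x i))) (Measure.pi fun _ => ν) := fun i =>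
      ((hev i).sub (integrable_const _)).const_mul s
    have hg : Integrable g (Measure.pi fun _ => ν) := integrable_finsetSum _ fun i _ => hgi i
    have hgF : ∀ y, g y ≤ F (x, y) := fun y =>
      Finset.le_sup' (fun h => ∑ i : Fin n, s * (truncSq τ θ₀ h (y i) - truncSq τ θ₀ h (x i))) hh
    have hexpg : Integrable (fun y => Real.exp (g y)) (Measure.pi fun _ => ν) :=
      hint.mono' (by fun_prop) (ae_of_all _ fun y => by
        rw [Real.norm_eq_abs, abs_of_pos (Real.exp_pos _)]
        exact Real.exp_le_exp.2 (hgF y))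
    have hmean : ∫ y, g y ∂(Measure.pi fun _ => ν) = s * ∑ i : Fin n,
        ((∫ y, truncSq τ θ₀ h y ∂ν) - truncSq τ θ₀ h (x i)) := by
      rw [integral_finsetSum _ fun i _ => hgi i, Finset.mul_sum]
      refine Finset.sum_congr rfl fun i _ => ?_
      rw [integral_const_mul, integral_sub (hev i) (integrable_const _)]
      congr 2
      · have := (measurePreserving_eval (fun _ : Fin n => ν) i).map_eq
        conv_rhs => rw [← this]
        rw [integral_map (measurable_pi_apply i).aemeasurable (hmeas h).aestronglyMeasurable]
      · simp
    rw [← hmean]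
    refine (convexOn_exp.map_integral_le Real.continuous_exp.continuousOn isClosed_univ
      (ae_of_all _ fun _ => Set.mem_univ _) hg hexpg).trans ?_
    exact integral_mono hexpg hint fun y => Real.exp_le_exp.2 (hgF y)
  refine (lintegral_mono hpoint).trans ?_
  have hFm : Measurable fun w => ENNReal.ofReal (Real.exp (F w)) := by fun_prop
  rw [← lintegral_prod _ hFm.aemeasurable]
  rw [← (measurePreserving_arrowProdEquivProdArrow (EuclideanSpace ℝ (Fin d))
    (EuclideanSpace ℝ (Fin d)) (Fin n) (fun _ => ν) (fun _ => ν)).lintegral_comp hFm]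
  exact lintegral_exp_sup'_truncSq_sub_le θ₀ hd hτ hM T hT hR hR0 hs

/-- Lower tail of the truncated quadratic process over a part of an `ℓ₁` ball. -/
theorem measure_centred_truncSq_gt_le (hd : 1 ≤ d) (hτ : 0 ≤ τ)
    {ν : Measure (EuclideanSpace ℝ (Fin d))} [IsProbabilityMeasure ν] {M : ℝ}
    (hM : ∀ᵐ x ∂ν, ∀ j, |x j| ≤ M) (S : Set (EuclideanSpace ℝ (Fin d))) {R s : ℝ}
    (hR : ∀ h ∈ S, l1Norm h ≤ R) (hR0 : 0 ≤ R) (hs : 0 ≤ s) (c : ℝ) :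
    (Measure.pi fun _ => ν) {x : Fin n → EuclideanSpace ℝ (Fin d) | ∃ h ∈ S,
        c < ∑ i, ((∫ y, truncSq τ θ₀ h y ∂ν) - truncSq τ θ₀ h (x i))} ≤
      ENNReal.ofReal (2 * d * Real.exp (n * ((4 * R * s * τ * M) ^ 2 / 2) - s * c)) := by
  have hmeas := fun h => measurable_truncSq (τ := τ) θ₀ h
  have hcont := fun x => continuous_truncSq (τ := τ) θ₀ x
  have hcint : Continuous fun h => ∫ y, truncSq τ θ₀ h y ∂ν :=
    continuous_of_dominated (bound := fun _ => τ ^ 2)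
      (fun h => (hmeas h).aestronglyMeasurable)
      (fun h => ae_of_all _ fun x => by
        rw [Real.norm_eq_abs, abs_of_nonneg (truncSq_nonneg θ₀ h x)]
        exact truncSq_le θ₀ h x) (integrable_const _) (ae_of_all _ hcont)
  refine measure_exists_lt_le_of_finset _ _ _ (fun z => ?_) c fun T hT hTS => ?_
  · exact continuous_finsetSum _ fun i _ => hcint.sub (hcont _)
  refine (measure_exists_lt_le_of_lintegral_exp _ T hT _ (fun h => ?_) c hs
    (lintegral_exp_sup'_centred_truncSq_le θ₀ hd hτ hM T hT (fun h hh => hR h (hTS h hh))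
      hR0 hs)).trans (le_of_eq ?_)
  · fun_prop
  · rw [sub_eq_add_neg, Real.exp_add, ← ENNReal.ofReal_mul (by positivity)]
    congr 1
    ring

end Design

/-! ### Population lower bound -/

lemma pow_four_le_exp (u : ℝ) : u ^ 4 ≤ 24 * (Real.exp u + Real.exp (-u)) := by
  have key : ∀ v : ℝ, 0 ≤ v → v ^ 4 ≤ 24 * Real.exp v := by
    intro v hv
    have := Real.pow_div_factorial_le_exp v hv 4
    rw [div_le_iff₀ (by positivity)] at this
    have e : ((Nat.factorial 4 : ℕ) : ℝ) = 24 := by norm_num [Nat.factorial]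
    rw [e] at this
    linarith
  rcases le_total 0 u with h | h
  · linarith [key u h, Real.exp_pos (-u)]
  · have := key (-u) (by linarith)
    rw [show (-u) ^ 4 = u ^ 4 by ring] at this
    linarith [Real.exp_pos u]

/-- Fourth powers pay for truncation: capping loses at most `u⁴ / τ²` up to a constant, and dropping
a point with `|w| > τ` loses `u² ≤ u² w² / τ² ≤ (u⁴ + w⁴) / (2 τ²)`. -/
lemma truncSq_ge {d : ℕ} {τ : ℝ} (hτ : 0 < τ) (θ₀ h x : EuclideanSpace ℝ (Fin d)) :
    inner ℝ x h ^ 2 - (3 * inner ℝ x h ^ 4 + inner ℝ x θ₀ ^ 4) / (2 * τ ^ 2) ≤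
      truncSq τ θ₀ h x := by
  set u : ℝ := inner ℝ x h
  set w : ℝ := inner ℝ x θ₀
  have hτ2 : 0 < τ ^ 2 := by positivity
  have h2 : 0 ≤ (3 * u ^ 4 + w ^ 4) / (2 * τ ^ 2) := by positivity
  unfold truncSq
  split_ifs with hw
  · refine le_min (by linarith) ?_
    have h3 : u ^ 2 - τ ^ 2 ≤ (3 * u ^ 4 + w ^ 4) / (2 * τ ^ 2) := by
      rw [le_div_iff₀ (by positivity)]
      nlinarith [sq_nonneg (u ^ 2 - τ ^ 2), sq_nonneg (u ^ 2), sq_nonneg (w ^ 2)]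
    linarith
  · push Not at hw
    have hw2 : τ ^ 2 ≤ w ^ 2 := by
      rw [← sq_abs w]; exact pow_le_pow_left₀ hτ.le hw.le 2
    have h3 : u ^ 2 ≤ (3 * u ^ 4 + w ^ 4) / (2 * τ ^ 2) := by
      rw [le_div_iff₀ (by positivity)]
      nlinarith [sq_nonneg (u ^ 2 - w ^ 2), sq_nonneg (u ^ 2),
        mul_le_mul_of_nonneg_left hw2 (sq_nonneg u)]
    linarith

section Moments

variable {d : ℕ} {ν : Measure (EuclideanSpace ℝ (Fin d))} [IsProbabilityMeasure ν] {M : ℝ}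

lemma abs_inner_le_of_bounded {x : EuclideanSpace ℝ (Fin d)} (hx : ∀ j, |x j| ≤ M)
    (v : EuclideanSpace ℝ (Fin d)) : |inner ℝ x v| ≤ M * l1Norm v := by
  rw [inner_eq_sum, l1Norm, Finset.mul_sum]
  refine (Finset.abs_sum_le_sum_abs _ _).trans (Finset.sum_le_sum fun j _ => ?_)
  rw [abs_mul]
  exact mul_le_mul_of_nonneg_right (hx j) (abs_nonneg _)

lemma integrable_continuous_inner (hM : ∀ᵐ x ∂ν, ∀ j, |x j| ≤ M)
    (v : EuclideanSpace ℝ (Fin d)) {g : ℝ → ℝ} (hg : Continuous g) :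
    Integrable (fun x => g (inner ℝ x v)) ν := by
  obtain ⟨C, hC⟩ := (isCompact_Icc (a := -(M * l1Norm v)) (b := M * l1Norm v)).exists_bound_of_continuousOn
    hg.continuousOn
  refine Integrable.of_bound (C := C)
    (hg.measurable.comp (by fun_prop)).aestronglyMeasurable ?_
  filter_upwards [hM] with x hx
  exact hC _ (abs_le.1 (abs_inner_le_of_bounded hx v))

/-- Free of the dimension: the bound comes from the sub-Gaussian moments at `v` and `-v`, and
coordinate boundedness serves only for integrability. -/
lemma integral_inner_pow_four_le (hM : ∀ᵐ x ∂ν, ∀ j, |x j| ≤ M)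
    (hsub : ∀ v : EuclideanSpace ℝ (Fin d),
      ∫ x, Real.exp (inner ℝ x v) ∂ν ≤ Real.exp (M ^ 2 * ‖v‖ ^ 2 / 2))
    (v : EuclideanSpace ℝ (Fin d)) {b : ℝ} (hb : ‖v‖ ≤ b) :
    ∫ x, inner ℝ x v ^ 4 ∂ν ≤ 48 * Real.exp (M ^ 2 * b ^ 2 / 2) := by
  have h1 : Integrable (fun x => Real.exp (inner ℝ x v)) ν :=
    integrable_continuous_inner hM v Real.continuous_exp
  have h2 : Integrable (fun x => Real.exp (-inner ℝ x v)) ν :=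
    integrable_continuous_inner hM v (g := fun t => Real.exp (-t)) (by fun_prop)
  have h3 : Integrable (fun x => inner ℝ x v ^ 4) ν :=
    integrable_continuous_inner hM v (continuous_pow 4)
  have h4 := hsub (-v)
  simp only [inner_neg_right, norm_neg] at h4
  have h5 : Real.exp (M ^ 2 * ‖v‖ ^ 2 / 2) ≤ Real.exp (M ^ 2 * b ^ 2 / 2) := by gcongr
  calc ∫ x, inner ℝ x v ^ 4 ∂ν
      ≤ ∫ x, 24 * (Real.exp (inner ℝ x v) + Real.exp (-inner ℝ x v)) ∂ν :=
        integral_mono h3 ((h1.add h2).const_mul 24) fun x => pow_four_le_exp _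
    _ = 24 * (∫ x, Real.exp (inner ℝ x v) ∂ν + ∫ x, Real.exp (-inner ℝ x v) ∂ν) := by
        rw [integral_const_mul, integral_add h1 h2]
    _ ≤ _ := by linarith [hsub v]

/-- The truncation level at which half of the curvature is retained. -/
noncomputable def truncLevel (M ρ M₀ : ℝ) : ℝ :=
  1 + (144 * Real.exp (M ^ 2 / 2) + 48 * Real.exp (M ^ 2 * M₀ ^ 2 / 2)) / ρ

lemma one_le_truncLevel {ρ : ℝ} (hρ : 0 < ρ) (M M₀ : ℝ) : 1 ≤ truncLevel M ρ M₀ := by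
  have : 0 ≤ (144 * Real.exp (M ^ 2 / 2) + 48 * Real.exp (M ^ 2 * M₀ ^ 2 / 2)) / ρ := by positivity
  unfold truncLevel
  linarith

theorem half_le_integral_truncSq {ρ M₀ : ℝ} (hρ : 0 < ρ) (hM : ∀ᵐ x ∂ν, ∀ j, |x j| ≤ M)
    (hsub : ∀ v : EuclideanSpace ℝ (Fin d),
      ∫ x, Real.exp (inner ℝ x v) ∂ν ≤ Real.exp (M ^ 2 * ‖v‖ ^ 2 / 2))
    (hquad : ∀ v : EuclideanSpace ℝ (Fin d), ρ * ‖v‖ ^ 2 ≤ ∫ x, inner ℝ x v ^ 2 ∂ν)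
    {θ₀ h : EuclideanSpace ℝ (Fin d)} (hθ : ‖θ₀‖ ≤ M₀) (hh : ‖h‖ = 1) :
    ρ / 2 ≤ ∫ x, truncSq (truncLevel M ρ M₀) θ₀ h x ∂ν := by
  set τ := truncLevel M ρ M₀ with hτ
  have hτ1 : 1 ≤ τ := one_le_truncLevel hρ M M₀
  have i2 : Integrable (fun x => inner ℝ x h ^ 2) ν :=
    integrable_continuous_inner hM h (continuous_pow 2)
  have i4 : Integrable (fun x => inner ℝ x h ^ 4) ν :=
    integrable_continuous_inner hM h (continuous_pow 4)
  have j4 : Integrable (fun x => inner ℝ x θ₀ ^ 4) ν :=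
    integrable_continuous_inner hM θ₀ (continuous_pow 4)
  have hi := integral_inner_pow_four_le hM hsub h hh.le
  have hj := integral_inner_pow_four_le hM hsub θ₀ hθ
  have hq := hquad h
  rw [hh] at hq
  simp only [one_pow, mul_one] at hq hi
  have hmono : ∫ x, (inner ℝ x h ^ 2 - (3 * inner ℝ x h ^ 4 + inner ℝ x θ₀ ^ 4) / (2 * τ ^ 2)) ∂ν ≤
      ∫ x, truncSq τ θ₀ h x ∂ν :=
    integral_mono (i2.sub (((i4.const_mul 3).add j4).div_const _)) (integrable_truncSq θ₀ ν h)
      fun x => truncSq_ge (by linarith) θ₀ h x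
  have h34 : Integrable (fun x => (3 * inner ℝ x h ^ 4 + inner ℝ x θ₀ ^ 4) / (2 * τ ^ 2)) ν :=
    ((i4.const_mul 3).add j4).div_const _
  rw [integral_sub i2 h34, integral_div, integral_add (i4.const_mul 3) j4,
    integral_const_mul] at hmono
  have hbound : (3 * ∫ x, inner ℝ x h ^ 4 ∂ν + ∫ x, inner ℝ x θ₀ ^ 4 ∂ν) / (2 * τ ^ 2) ≤ ρ / 2 := by
    rw [div_le_iff₀ (by positivity)]
    -- The fourth-moment bounds contribute `3 * 48 = 144` and `48`. The summand `1` in `truncLevel`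
    -- gives `τ ≤ τ²`, so a level linear in `1 / ρ` suffices.
    have e : (144 * Real.exp (M ^ 2 / 2) + 48 * Real.exp (M ^ 2 * M₀ ^ 2 / 2)) ≤ ρ * τ := by
      rw [hτ, truncLevel, mul_add, mul_div_cancel₀ _ hρ.ne']
      linarith
    have e2 : ρ * τ ≤ ρ * τ ^ 2 := by
      have : τ ≤ τ ^ 2 := by nlinarith
      gcongr
    linarith
  linarith

end Moments

/-! ### Restricted strong convexity -/

/-- The normalized deviation level in the restricted strong convexity event. -/
noncomputable def coneConst (M ρ τ : ℝ) : ℝ := (ρ / 4) / (9 * τ * (|M| + 1))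

lemma coneConst_pos {M ρ τ : ℝ} (hρ : 0 < ρ) (hτ : 0 < τ) : 0 < coneConst M ρ τ := by
  unfold coneConst; positivity

/-- With high probability the truncated empirical quadratic form is bounded below on a cone. -/
theorem measure_truncSq_cone_le {d n : ℕ} (hn : 1 ≤ n) (hd : 1 ≤ d)
    {ν : Measure (EuclideanSpace ℝ (Fin d))} [IsProbabilityMeasure ν] {M ρ τ : ℝ} (hρ : 0 < ρ)
    (hτ : 0 < τ) (hM : ∀ᵐ x ∂ν, ∀ j, |x j| ≤ M) (θ₀ : EuclideanSpace ℝ (Fin d))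
    (hpop : ∀ h : EuclideanSpace ℝ (Fin d), ‖h‖ = 1 → ρ / 2 ≤ ∫ x, truncSq τ θ₀ h x ∂ν) :
    (Measure.pi fun _ => ν) {x : Fin n → EuclideanSpace ℝ (Fin d) |
      ∃ h, ‖h‖ = 1 ∧ l1Norm h ≤ coneConst M ρ τ / rate n d ∧
        ∑ i, truncSq τ θ₀ h (x i) < n * (ρ / 4)} ≤ ENNReal.ofReal (1 / n) := by
  have hn1 : (1 : ℝ) ≤ n := by exact_mod_cast hn
  have hd1 : (1 : ℝ) ≤ d := by exact_mod_cast hd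
  have hr := rate_pos hn hd
  have ha := coneConst_pos (M := M) hρ hτ
  set a := coneConst M ρ τ with hadef
  have hpos : (0 : ℝ) < 4 * n * d := by positivity
  refine (measure_mono ?_).trans ((measure_centred_truncSq_gt_le θ₀ hd hτ.le hM
    {h | ‖h‖ = 1 ∧ l1Norm h ≤ a / rate n d} (R := a / rate n d)
    (s := 3 * rate n d ^ 2 / (ρ / 4)) (fun h hh => hh.2) (by positivity) (by positivity)
    (n * (ρ / 4))).trans (ENNReal.ofReal_le_ofReal ?_))
  · rintro x ⟨h, h1, h2, h3⟩
    refine ⟨h, ⟨h1, h2⟩, ?_⟩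
    rw [Finset.sum_sub_distrib]
    have := hpop h h1
    simp only [Finset.sum_const, Finset.card_univ, Fintype.card_fin, nsmul_eq_mul]
    nlinarith
  -- The choice of `s` makes the linear term exactly `3 log (4nd)`. The `9` in `coneConst` makes the
  -- quadratic one at most `(12/9)² / 2 < 1` times the logarithm, so two logarithms remain.
  · have hexp : n * ((4 * (a / rate n d) * (3 * rate n d ^ 2 / (ρ / 4)) * τ * M) ^ 2 / 2) -
        3 * rate n d ^ 2 / (ρ / 4) * (n * (ρ / 4)) ≤ -((2 : ℕ) * Real.log (4 * n * d)) := by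
      rw [← rate_sq hn hd]
      have e1 : 3 * rate n d ^ 2 / (ρ / 4) * (n * (ρ / 4)) = 3 * (n * rate n d ^ 2) := by
        field_simp
      have e2 : 4 * (a / rate n d) * (3 * rate n d ^ 2 / (ρ / 4)) * τ * M =
          (12 / 9 * (M / (|M| + 1))) * rate n d := by
        rw [hadef, coneConst]
        have : |M| + 1 ≠ 0 := by positivity
        field_simp
        ring
      have e3 : (M / (|M| + 1)) ^ 2 ≤ 1 := by
        rw [← sq_abs, abs_div, abs_of_pos (by positivity : 0 < |M| + 1)]
        refine pow_le_one₀ (by positivity) ?_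
        rw [div_le_one (by positivity)]
        linarith
      rw [e1, e2, mul_pow, mul_pow]
      have h0 : 0 ≤ n * rate n d ^ 2 := by positivity
      push_cast
      nlinarith [mul_le_mul_of_nonneg_left e3 h0]
    calc _ ≤ 2 * d * Real.exp (-((2 : ℕ) * Real.log (4 * n * d))) := by gcongr
      _ = 2 * d / (4 * n * d : ℝ) ^ 2 := by
          rw [Real.exp_neg, Real.exp_nat_mul, Real.exp_log hpos]
          rfl
      _ ≤ 1 / n := by
          rw [div_le_div_iff₀ (by positivity) (by positivity)]
          have h1 : (d : ℝ) * n ≤ d ^ 2 * n ^ 2 := by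
            have : (1 : ℝ) ≤ d * n := one_le_mul_of_one_le_of_one_le hd1 hn1
            nlinarith
          nlinarith

/-- Local growth of the link function. -/
lemma link_growth {f : ℝ → ℝ} (hf : Differentiable ℝ f) (hpos : ∀ t, 0 < deriv f t) {c τ : ℝ}
    (hc : 0 < c) (hder : ∀ t, |t| ≤ τ + 1 → c ≤ deriv f t) {w : ℝ} (hw : |w| ≤ τ) (u : ℝ) :
    c ^ 2 * min (u ^ 2) 1 ≤ (f (w + u) - f w) ^ 2 := by
  have hmono : StrictMono f := strictMono_of_deriv_pos hpos
  have hw' := abs_le.1 hw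
  have hgrow : ∀ x ∈ Set.Icc (-(τ + 1)) (τ + 1), ∀ y ∈ Set.Icc (-(τ + 1)) (τ + 1), x ≤ y →
      c * (y - x) ≤ f y - f x :=
    (convex_Icc _ _).mul_sub_le_image_sub_of_le_deriv hf.continuous.continuousOn
      hf.differentiableOn fun x hx => hder x (abs_le.2 (Set.mem_Icc.1 (interior_subset hx)))
  -- The first unit of the displacement stays in `[-(τ + 1), τ + 1]`, where the slope is at least
  -- `c`; past it, monotonicity loses nothing.
  have habs : c * min |u| 1 ≤ |f (w + u) - f w| := by
    rcases le_total 0 u with hu | hu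
    · have h1 := hgrow w ⟨by linarith, by linarith⟩ (w + min u 1)
        ⟨by linarith [le_min hu zero_le_one], by linarith [min_le_right u 1]⟩
        (by linarith [le_min hu zero_le_one])
      have h2 := hmono.monotone (show w + min u 1 ≤ w + u by linarith [min_le_left u 1])
      rw [abs_of_nonneg hu]
      refine le_trans ?_ (le_abs_self _)
      linarith
    · have h0 : 0 ≤ min (-u) 1 := le_min (by linarith) zero_le_one
      have h1 := hgrow (w - min (-u) 1) ⟨by linarith [min_le_right (-u) 1], by linarith⟩ w
        ⟨by linarith, by linarith⟩ (by linarith)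
      have h2 := hmono.monotone (show w + u ≤ w - min (-u) 1 by linarith [min_le_left (-u) 1])
      rw [abs_of_nonpos hu, abs_sub_comm]
      refine le_trans ?_ (le_abs_self _)
      linarith
  have e : min (u ^ 2) 1 = min |u| 1 ^ 2 := by
    rcases le_total |u| 1 with h | h
    · rw [min_eq_left h, sq_abs, min_eq_left]
      rw [← sq_abs]; exact pow_le_one₀ (abs_nonneg _) h
    · rw [min_eq_right h, one_pow, min_eq_right]
      rw [← sq_abs]; exact one_le_pow₀ h
  rw [e, ← mul_pow, ← sq_abs (f (w + u) - f w)]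
  exact pow_le_pow_left₀ (mul_nonneg hc.le (le_min (abs_nonneg _) zero_le_one)) habs 2

/-- The empirical excess risk is bounded below on a cone when the truncated form is. -/
theorem empirical_growth {d n : ℕ} {f : ℝ → ℝ} (hf : Differentiable ℝ f)
    (hpos : ∀ t, 0 < deriv f t) {c τ ρ R₀ : ℝ} (hc : 0 < c) (hτ : 0 < τ)
    (hder : ∀ t, |t| ≤ τ + 1 → c ≤ deriv f t) (θ₀ : EuclideanSpace ℝ (Fin d))
    (x : Fin n → EuclideanSpace ℝ (Fin d))
    (hx : ∀ h, ‖h‖ = 1 → l1Norm h ≤ R₀ → n * (ρ / 4) ≤ ∑ i, truncSq τ θ₀ h (x i))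
    (h : EuclideanSpace ℝ (Fin d)) (hh : h ≠ 0) (hcone : l1Norm h ≤ R₀ * ‖h‖) :
    n * (c ^ 2 * (ρ / 4) * min (‖h‖ ^ 2) (1 / τ ^ 2)) ≤
      ∑ i, (f (inner ℝ (x i) (θ₀ + h)) - f (inner ℝ (x i) θ₀)) ^ 2 := by
  have hr : 0 < ‖h‖ := norm_pos_iff.2 hh
  set r := ‖h‖
  set q := min (r ^ 2) (1 / τ ^ 2) with hq
  have hq0 : 0 ≤ q := by positivity
  have h1 := hx (r⁻¹ • h) (by rw [norm_smul, norm_inv, norm_norm, inv_mul_cancel₀ hr.ne']) (by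
    have e : l1Norm (r⁻¹ • h) = r⁻¹ * l1Norm h := by
      simp only [l1Norm, PiLp.smul_apply, smul_eq_mul, abs_mul, ← Finset.mul_sum, abs_inv,
        abs_of_pos hr]
    rw [e, inv_mul_le_iff₀ hr, mul_comm]
    exact hcone)
  -- The factor `q` undoes the normalization while keeping both caps: `q * min (u² / r²) (τ²) ≤ min
  -- (u²) 1`.
  have h2 : ∀ i, c ^ 2 * q * truncSq τ θ₀ (r⁻¹ • h) (x i) ≤
      (f (inner ℝ (x i) (θ₀ + h)) - f (inner ℝ (x i) θ₀)) ^ 2 := by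
    intro i
    unfold truncSq
    split_ifs with hw
    · rw [inner_add_right]
      refine le_trans ?_ (link_growth hf hpos hc hder hw _)
      rw [mul_assoc]
      refine mul_le_mul_of_nonneg_left ?_ (by positivity)
      rw [real_inner_smul_right, mul_pow]
      set u : ℝ := inner ℝ (x i) h
      refine le_min ?_ ?_
      · calc q * min (r⁻¹ ^ 2 * u ^ 2) (τ ^ 2) ≤ r ^ 2 * (r⁻¹ ^ 2 * u ^ 2) :=
              mul_le_mul (min_le_left _ _) (min_le_left _ _) (by positivity) (by positivity)
          _ = u ^ 2 := by field_simp
      · calc q * min (r⁻¹ ^ 2 * u ^ 2) (τ ^ 2) ≤ 1 / τ ^ 2 * τ ^ 2 :=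
              mul_le_mul (min_le_right _ _) (min_le_right _ _) (by positivity) (by positivity)
          _ = 1 := by field_simp
    · rw [mul_zero]; positivity
  calc n * (c ^ 2 * (ρ / 4) * q) = c ^ 2 * q * (n * (ρ / 4)) := by ring
    _ ≤ c ^ 2 * q * ∑ i, truncSq τ θ₀ (r⁻¹ • h) (x i) := by gcongr
    _ ≤ _ := by
        rw [Finset.mul_sum]
        exact Finset.sum_le_sum fun i _ => h2 i

/-! ### The design assumptions -/

/-- An eigenvector of `A - ρ I` with eigenvalue `e` is one of `A` with eigenvalue `e + ρ ≥ ρ`. Hence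
`A - ρ I` is positive semidefinite. -/
lemma IsRegularDesign.quadratic_ge {d : ℕ} {M ρ : ℝ}
    {P : Measure (EuclideanSpace ℝ (Fin d) × ℝ)} [IsProbabilityMeasure P]
    (h : IsRegularDesign M ρ P) (v : EuclideanSpace ℝ (Fin d)) :
    ρ * ‖v‖ ^ 2 ≤ ∫ z, inner ℝ z.1 v ^ 2 ∂P := by
  set A := secondMoment P with hA
  have hsymm : A.IsHermitian := by
    ext j k
    simp [hA, secondMoment, Matrix.conjTranspose_apply, mul_comm]
  have hB : (A - ρ • (1 : Matrix (Fin d) (Fin d) ℝ)).IsHermitian := by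
    refine hsymm.sub ?_
    ext j k
    simp [Matrix.conjTranspose_apply, Matrix.one_apply, eq_comm]
  have hpsd : (A - ρ • (1 : Matrix (Fin d) (Fin d) ℝ)).PosSemidef := by
    rw [hB.posSemidef_iff_eigenvalues_nonneg]
    intro i
    have h1 := hB.mulVec_eigenvectorBasis i
    have h2 : (hB.eigenvectorBasis i).ofLp ≠ 0 :=
      (WithLp.ofLp_eq_zero 2).ne.2 (hB.eigenvectorBasis.orthonormal.ne_zero i)
    rw [Matrix.sub_mulVec, Matrix.smul_mulVec, Matrix.one_mulVec, sub_eq_iff_eq_add,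
      ← add_smul] at h1
    have h3 := h.eigenvalue_ge (hB.eigenvalues i + ρ)
      (Module.End.hasEigenvalue_of_hasEigenvector
        (Module.End.hasEigenvector_iff.2 ⟨Module.End.mem_eigenspace_iff.2 (by
          rw [Matrix.toLin'_apply]; exact h1), h2⟩))
    simpa using h3
  have h4 := hpsd.dotProduct_mulVec_nonneg v.ofLp
  have hint : ∀ j k, Integrable (fun z : EuclideanSpace ℝ (Fin d) × ℝ => z.1 j * z.1 k) P := by
    intro j k
    refine Integrable.of_bound (C := M * M) (by fun_prop) ?_
    filter_upwards [h.bounded] with z hz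
    rw [Real.norm_eq_abs, abs_mul]
    exact mul_le_mul (hz j) (hz k) (abs_nonneg _) ((abs_nonneg _).trans (hz j))
  have h5 : ∫ z, inner ℝ z.1 v ^ 2 ∂P = ∑ j, ∑ k, v j * (A j k * v k) := by
    have e : ∀ z : EuclideanSpace ℝ (Fin d) × ℝ, (inner ℝ z.1 v : ℝ) ^ 2 =
        ∑ j, ∑ k, v j * ((z.1 j * z.1 k) * v k) := by
      intro z
      rw [inner_eq_sum, sq, Finset.sum_mul_sum]
      exact Finset.sum_congr rfl fun j _ => Finset.sum_congr rfl fun k _ => by ring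
    simp only [e]
    rw [integral_finsetSum _ fun j _ => integrable_finsetSum _ fun k _ =>
      ((hint j k).mul_const _).const_mul _]
    refine Finset.sum_congr rfl fun j _ => ?_
    rw [integral_finsetSum _ fun k _ => ((hint j k).mul_const _).const_mul _]
    refine Finset.sum_congr rfl fun k _ => ?_
    rw [integral_const_mul, integral_mul_const]
    rfl
  have h6 : ‖v‖ ^ 2 = v.ofLp ⬝ᵥ v.ofLp := by
    rw [EuclideanSpace.real_norm_sq_eq]
    simp [dotProduct, sq]
  rw [h5, h6]
  rw [Matrix.sub_mulVec, Matrix.smul_mulVec, Matrix.one_mulVec, dotProduct_sub,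
    dotProduct_smul] at h4
  simp only [star_trivial, smul_eq_mul] at h4
  have h7 : v.ofLp ⬝ᵥ (A.mulVec v.ofLp) = ∑ j, ∑ k, v j * (A j k * v k) := by
    simp [dotProduct, Matrix.mulVec, Finset.mul_sum]
  linarith

/-! ### The basic inequality -/

lemma sum_abs_support_le {d : ℕ} (θ h : EuclideanSpace ℝ (Fin d)) :
    ∑ j with θ j ≠ 0, |h j| ≤ √(numNonzero θ) * ‖h‖ := by
  have hcard : (numNonzero θ : ℝ) = (Finset.univ.filter fun j => θ j ≠ 0).card := by
    rw [numNonzero, Set.ncard_eq_toFinset_card', Set.toFinset_ofPred]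
  rw [hcard, EuclideanSpace.norm_eq, ← Real.sqrt_mul (by positivity)]
  refine Real.le_sqrt_of_sq_le (sq_sum_le_card_mul_sum_sq.trans ?_)
  refine mul_le_mul_of_nonneg_left ?_ (by positivity)
  simp only [Real.norm_eq_abs]
  exact Finset.sum_le_univ_sum_of_nonneg fun j => by positivity

/-- Sparsity enters here: coordinates off the support of `θ` cancel, those on it contribute at most
`2 |h j|`, and Cauchy–Schwarz does the rest. -/
lemma l1Norm_sub_add_le {d : ℕ} (θ h : EuclideanSpace ℝ (Fin d)) :
    l1Norm θ - l1Norm (θ + h) + l1Norm h ≤ 2 * (√(numNonzero θ) * ‖h‖) := by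
  refine le_trans ?_ (mul_le_mul_of_nonneg_left (sum_abs_support_le θ h) zero_le_two)
  rw [l1Norm, l1Norm, l1Norm, ← Finset.sum_sub_distrib, ← Finset.sum_add_distrib,
    Finset.mul_sum, Finset.sum_filter]
  refine Finset.sum_le_sum fun j _ => ?_
  split_ifs with hj
  · have := abs_sub_abs_le_abs_sub (θ j) (θ j + h j)
    rw [sub_add_cancel_left, abs_neg] at this
    simp only [PiLp.add_apply]
    linarith
  · push Not at hj
    simp [hj]

lemma l1Norm_add_le {d : ℕ} (θ h : EuclideanSpace ℝ (Fin d)) :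
    l1Norm h ≤ l1Norm (θ + h) + l1Norm θ := by
  rw [l1Norm, l1Norm, l1Norm, ← Finset.sum_add_distrib]
  refine Finset.sum_le_sum fun j _ => ?_
  have := abs_sub (θ j + h j) (θ j)
  rw [add_sub_cancel_left] at this
  simpa using this

lemma one_le_numNonzero {d : ℕ} {θ : EuclideanSpace ℝ (Fin d)} (hθ : θ ≠ 0) :
    1 ≤ numNonzero θ := by
  have : {j | θ j ≠ 0}.Nonempty := by
    by_contra hcon
    rw [Set.not_nonempty_iff_eq_empty] at hcon
    refine hθ ?_
    ext j
    by_contra hj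
    have : j ∈ {j | θ j ≠ 0} := hj
    rw [hcon] at this
    exact this
  exact (Set.ncard_pos (Set.toFinite _)).2 this

/-- The residuals `(Xᵢ, Yᵢ - f (Xᵢᵀ θ₀))` of the data. -/
noncomputable def residuals {n d : ℕ} (f : ℝ → ℝ) (θ₀ : EuclideanSpace ℝ (Fin d))
    (z : Fin n → EuclideanSpace ℝ (Fin d) × ℝ) : Fin n → EuclideanSpace ℝ (Fin d) × ℝ :=
  fun i => ((z i).1, (z i).2 - f (inner ℝ (z i).1 θ₀))

lemma basic_inequality {n d : ℕ} {f : ℝ → ℝ} {lam : ℝ} {θ₀ h : EuclideanSpace ℝ (Fin d)}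
    {z : Fin n → EuclideanSpace ℝ (Fin d) × ℝ}
    (hmin : criterion f lam z (θ₀ + h) ≤ criterion f lam z θ₀) :
    1 / n * ∑ i, (f (inner ℝ (z i).1 (θ₀ + h)) - f (inner ℝ (z i).1 θ₀)) ^ 2 +
      lam * l1Norm (θ₀ + h) ≤
      2 / n * noiseSum f θ₀ h (residuals f θ₀ z) + lam * l1Norm θ₀ := by
  unfold criterion at hmin
  have e : ∑ i, ((z i).2 - f (inner ℝ (z i).1 (θ₀ + h))) ^ 2 =
      ∑ i, ((z i).2 - f (inner ℝ (z i).1 θ₀)) ^ 2 +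
        ∑ i, (f (inner ℝ (z i).1 (θ₀ + h)) - f (inner ℝ (z i).1 θ₀)) ^ 2 -
        2 * noiseSum f θ₀ h (residuals f θ₀ z) := by
    simp only [noiseSum, residuals, Finset.mul_sum, ← Finset.sum_add_distrib,
      ← Finset.sum_sub_distrib]
    exact Finset.sum_congr rfl fun i _ => by ring
  rw [e, mul_sub, mul_add] at hmin
  have e2 : 2 / n * noiseSum f θ₀ h (residuals f θ₀ z) =
      1 / n * (2 * noiseSum f θ₀ h (residuals f θ₀ z)) := by ring
  linarith

/-- Conversion of the cone and growth inequalities into a bound on the error. -/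
lemma error_bound_of_growth {R r s Q lam l δ t C a κ τ : ℝ} (hs : 0 ≤ s)
    (hl : 0 < l) (hlam : 0 < lam) (hδ : 0 ≤ δ) (ha : 0 < a) (hκ : 0 < κ)
    (hC : lam ≤ C * l) (h1 : R ≤ 4 * t + δ) (h2 : R ≤ 4 * (√s * r) + δ)
    (h3 : Q ≤ 3 / 2 * lam * R + lam * δ / 2)
    (h4 : 0 < R → R ≤ a / l * r → κ * min (r ^ 2) (1 / τ ^ 2) ≤ Q)
    (h5 : 8 * (l * t) ≤ 1) (h6 : 16 * C * (l * t) < κ * (1 / τ ^ 2)) (h7 : δ ≤ s * l) :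
    R ≤ (2 + 64 / a ^ 2 + 128 * C / κ) * (s * l) := by
  -- In the application `R = |h|₁`, `r = ‖h‖`, `s = s₀`, `l` is the rate, `t = |θ₀|₁`, `δ = 1/n`,
  -- and `Q` is the empirical excess risk.
  have hC0 : 0 < C := by
    by_contra hcon
    push Not at hcon
    nlinarith
  have hsl : 0 ≤ s * l := by positivity
  have hss : √s ^ 2 = s := Real.sq_sqrt hs
  have p1 : 0 ≤ 64 / a ^ 2 * (s * l) := by positivity
  have p2 : 0 ≤ 128 * C / κ * (s * l) := by positivity
  rw [add_mul, add_mul]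
  -- If `R ≤ 2 δ`, the summand `2` of the constant suffices; otherwise `δ` is absorbed in `R`.
  rcases le_or_gt R (2 * δ) with hRδ | hRδ
  · linarith
  have hR0 : 0 < R := by linarith
  have hRt : R ≤ 8 * t := by linarith
  have hRr : R ≤ 8 * (√s * r) := by linarith
  have hQ : Q ≤ 2 * lam * R := by nlinarith
  rcases le_or_gt R (a / l * r) with hcone | hcone
  · have h8 := h4 hR0 hcone
    have hR2 : R ^ 2 ≤ 64 * s * r ^ 2 := by
      calc R ^ 2 ≤ (8 * (√s * r)) ^ 2 := by gcongr
        _ = 64 * √s ^ 2 * r ^ 2 := by ring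
        _ = _ := by rw [hss]
    rcases le_total (r ^ 2) (1 / τ ^ 2) with hmin | hmin
    · rw [min_eq_left hmin] at h8
      have h9 : κ * R ≤ 128 * s * lam := by
        have : κ * R ^ 2 ≤ 128 * s * lam * R := by nlinarith
        nlinarith
      have h10 : κ * R ≤ 128 * C * (s * l) := by nlinarith
      have h11 : R ≤ 128 * C / κ * (s * l) := by
        rw [div_mul_eq_mul_div, le_div_iff₀ hκ]
        linarith
      linarith
    -- Saturated growth would force `κ / τ² ≤ Q ≤ 2 lam R ≤ 16 C l t`, against `h6`.
    · rw [min_eq_right hmin] at h8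
      exfalso
      have : lam * R ≤ C * l * (8 * t) :=
        mul_le_mul hC hRt hR0.le (by positivity)
      nlinarith
  -- Outside the cone, `R ≤ 8 √s r` forces `a ≤ 8 √s l`, that is `1 ≤ 64 s l² / a²`; multiplying by
  -- `R ≤ 1 / l` gives the claim without curvature.
  · have hlR : l * R ≤ 1 := by nlinarith
    have h8 : a * R ≤ 8 * √s * l * R := by
      have h9 : a * r ≤ R * l := by
        have := hcone.le
        rw [div_mul_eq_mul_div, div_le_iff₀ hl] at this
        exact this
      have h10 : a * R ≤ 8 * √s * (a * r) := by nlinarith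
      have h11 : 0 ≤ 8 * √s := by positivity
      nlinarith
    have h9 : a ≤ 8 * √s * l := le_of_mul_le_mul_right h8 hR0
    have h10 : a ^ 2 ≤ 64 * s * l ^ 2 := by
      calc a ^ 2 ≤ (8 * √s * l) ^ 2 := by gcongr
        _ = 64 * √s ^ 2 * l ^ 2 := by ring
        _ = _ := by rw [hss]
    have h11 : R ≤ 64 / a ^ 2 * (s * l) := by
      rw [div_mul_eq_mul_div, le_div_iff₀ (by positivity)]
      have h12 : R * a ^ 2 ≤ R * (64 * s * l ^ 2) := by gcongr
      have h13 : R * (64 * s * l ^ 2) = 64 * (s * l) * (l * R) := by ring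
      nlinarith
    linarith

/-- The error bound at a given sample on which the noise is dominated and the growth condition
holds. -/
theorem l1Norm_error_le {n d : ℕ} (hn : 1 ≤ n) (hd : 1 ≤ d) {f : ℝ → ℝ}
    {θ₀ θ : EuclideanSpace ℝ (Fin d)} (hθ₀ : θ₀ ≠ 0)
    {z : Fin n → EuclideanSpace ℝ (Fin d) × ℝ} {lam K C a κ τ : ℝ} (hK : 0 < K) (ha : 0 < a)
    (hκ : 0 < κ) (hmin : criterion f lam z θ ≤ criterion f lam z θ₀)
    (hlam : K * rate n d ≤ lam) (hC : lam ≤ C * rate n d)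
    (hnoise : ∀ h, |noiseSum f θ₀ h (residuals f θ₀ z)| ≤
      K / 4 * (n * rate n d * (l1Norm h + 1 / n)))
    (hgrowth : ∀ h, h ≠ 0 → l1Norm h ≤ a / rate n d * ‖h‖ →
      n * (κ * min (‖h‖ ^ 2) (1 / τ ^ 2)) ≤
        ∑ i, (f (inner ℝ (z i).1 (θ₀ + h)) - f (inner ℝ (z i).1 θ₀)) ^ 2)
    (h5 : 8 * (rate n d * l1Norm θ₀) ≤ 1)
    (h6 : 16 * C * (rate n d * l1Norm θ₀) < κ * (1 / τ ^ 2)) :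
    l1Norm (θ - θ₀) ≤
      (2 + 64 / a ^ 2 + 128 * C / κ) * (numNonzero θ₀ * rate n d) := by
  have hn1 : (1 : ℝ) ≤ n := by exact_mod_cast hn
  have hr := rate_pos hn hd
  set l := rate n d with hl
  obtain ⟨h, rfl⟩ : ∃ h, θ = θ₀ + h := ⟨θ - θ₀, by simp⟩
  rw [add_sub_cancel_left]
  have hlam0 : 0 < lam := lt_of_lt_of_le (by positivity) hlam
  have hb := basic_inequality hmin
  have hR0 := l1Norm_nonneg h
  set Q := 1 / n * ∑ i, (f (inner ℝ (z i).1 (θ₀ + h)) - f (inner ℝ (z i).1 θ₀)) ^ 2 with hQ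
  have hQ0 : 0 ≤ Q := by positivity
  have hnz : 2 / n * noiseSum f θ₀ h (residuals f θ₀ z) ≤ lam / 2 * (l1Norm h + 1 / n) := by
    have h7 := (le_abs_self _).trans (hnoise h)
    calc 2 / n * noiseSum f θ₀ h (residuals f θ₀ z)
        ≤ 2 / n * (K / 4 * (n * l * (l1Norm h + 1 / n))) := by gcongr
      _ = K * l / 2 * (l1Norm h + 1 / n) := by field_simp; ring
      _ ≤ lam / 2 * (l1Norm h + 1 / n) := by gcongr
  have hδ : (0 : ℝ) ≤ 1 / n := by positivity
  have g1 := l1Norm_add_le θ₀ h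
  have g2 := l1Norm_sub_add_le θ₀ h
  -- Obtained by dropping `Q`. With `g1` it gives `R ≤ 4 t + δ`, with `g2` it gives `R ≤ 4 √s r +
  -- δ`.
  have g3 : l1Norm (θ₀ + h) ≤ l1Norm θ₀ + (l1Norm h + 1 / n) / 2 := by
    have : lam * l1Norm (θ₀ + h) ≤ lam * (l1Norm θ₀ + (l1Norm h + 1 / n) / 2) := by linarith
    exact le_of_mul_le_mul_left this hlam0
  have g4 : l1Norm θ₀ ≤ l1Norm (θ₀ + h) + l1Norm h := by
    rw [add_comm θ₀ h]; exact l1Norm_add_le h θ₀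
  refine error_bound_of_growth (r := ‖h‖) (Q := Q) (δ := 1 / n) (t := l1Norm θ₀) (τ := τ)
    (by positivity) hr hlam0 hδ ha hκ hC (by linarith) (by linarith) ?_ ?_ h5 h6 ?_
  · have : lam * (l1Norm θ₀ - l1Norm (θ₀ + h)) ≤ lam * l1Norm h := by
      gcongr; linarith
    linarith
  · intro hpos hcone
    have hne : h ≠ 0 := by
      rintro rfl
      simp [l1Norm] at hpos
    have := hgrowth h hne hcone
    rw [hQ, div_mul_eq_mul_div, one_mul, le_div_iff₀ (by positivity)]
    linarith
  -- The slack `1 / n` is below `s₀ * rate` because `s₀ ≥ 1`, which is where `θ₀ ≠ 0` matters.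
  · have h1 : (1 : ℝ) ≤ numNonzero θ₀ := by exact_mod_cast one_le_numNonzero hθ₀
    have h2 := one_le_sqrt_mul_rate hn hd
    have h3 : √(n : ℝ) ≤ n := Real.sqrt_le_iff.2 ⟨by positivity, by nlinarith⟩
    rw [div_le_iff₀ (by positivity)]
    have h4 : 1 ≤ n * l := h2.trans (by gcongr)
    nlinarith

/-! ### The link function -/

lemma IsRegularLink.deriv_pos' {f : ℝ → ℝ} (hf : IsRegularLink f) (t : ℝ) : 0 < deriv f t := by
  obtain ⟨c, hc, h⟩ := hf.deriv_pos (|t| + 1) (by positivity)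
  exact hc.trans_le (h t (by linarith))

lemma IsRegularLink.exists_bound {f : ℝ → ℝ} (hf : IsRegularLink f) :
    ∃ B : ℝ, 0 ≤ B ∧ (∀ t, |f t| ≤ B) ∧ ∀ s t, |f s - f t| ≤ B * |s - t| := by
  obtain ⟨B, hB⟩ := hf.bounded
  refine ⟨B, (abs_nonneg _).trans (hB 0).1, fun t => (hB t).1, fun s t => ?_⟩
  have := (convex_univ (𝕜 := ℝ) (E := ℝ)).norm_image_sub_le_of_norm_deriv_le (f := f) (C := B)
    (x := t) (y := s) (fun x _ => hf.differentiable x)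
    (fun x _ => by
      rw [Real.norm_eq_abs, abs_of_pos (hf.deriv_pos' x)]
      exact (hB x).2) (Set.mem_univ _) (Set.mem_univ _)
  simpa [Real.norm_eq_abs] using this

/-! ### The law of the residuals -/

/-- The law of the covariates. -/
noncomputable def covariateLaw {d : ℕ} (P : Measure (EuclideanSpace ℝ (Fin d) × ℝ)) :
    Measure (EuclideanSpace ℝ (Fin d)) := P.map Prod.fst

instance {d : ℕ} (P : Measure (EuclideanSpace ℝ (Fin d) × ℝ)) [IsProbabilityMeasure P] :
    IsProbabilityMeasure (covariateLaw P) :=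
  Measure.isProbabilityMeasure_map measurable_fst.aemeasurable

/-- A conditional law given by a constant kernel is independence, so `(X, ε)` has a product law. -/
lemma IsGaussianSingleIndex.hasLaw {d : ℕ} {f : ℝ → ℝ} {σ : ℝ≥0}
    {θ₀ : EuclideanSpace ℝ (Fin d)} {P : Measure (EuclideanSpace ℝ (Fin d) × ℝ)}
    [IsProbabilityMeasure P] (h : IsGaussianSingleIndex f σ θ₀ P) :
    HasLaw (fun z : EuclideanSpace ℝ (Fin d) × ℝ => (z.1, z.2 - f (inner ℝ z.1 θ₀)))
      (noiseLaw σ (covariateLaw P)) P := by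
  have h1 : HasLaw (fun z : EuclideanSpace ℝ (Fin d) × ℝ => (z.1, z.2 - f (inner ℝ z.1 θ₀)))
      ((P.map Prod.fst) ⊗ₘ (Kernel.const (EuclideanSpace ℝ (Fin d)) (gaussianReal 0 (σ ^ 2)))) P := h
  rwa [Measure.compProd_const] at h1

lemma hasLaw_residuals {n d : ℕ} {Ω : Type*} [MeasurableSpace Ω] {μ : Measure Ω}
    [IsProbabilityMeasure μ] {f : ℝ → ℝ} (hfm : Measurable f) {σ : ℝ≥0}
    {θ₀ : EuclideanSpace ℝ (Fin d)} {P : Measure (EuclideanSpace ℝ (Fin d) × ℝ)}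
    [IsProbabilityMeasure P] (h : IsGaussianSingleIndex f σ θ₀ P)
    {Z : Fin n → Ω → EuclideanSpace ℝ (Fin d) × ℝ} (hind : iIndepFun Z μ)
    (hlaw : ∀ i, HasLaw (Z i) P μ) :
    HasLaw (fun ω => residuals f θ₀ fun i => Z i ω)
      (Measure.pi fun _ => noiseLaw σ (covariateLaw P)) μ := by
  have hg : Measurable fun z : EuclideanSpace ℝ (Fin d) × ℝ =>
      (z.1, z.2 - f (inner ℝ z.1 θ₀)) := by fun_prop
  have h1 := hind.comp (fun _ => fun z : EuclideanSpace ℝ (Fin d) × ℝ =>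
      (z.1, z.2 - f (inner ℝ z.1 θ₀))) fun _ => hg
  exact h1.hasLaw_pi fun i => h.hasLaw.comp (hlaw i)

/-- The inequality holds for arbitrary sets, so the bad events, defined by quantifying over all `h`,
need not be shown measurable. -/
lemma measure_preimage_le_of_hasLaw {Ω 𝒳 : Type*} [MeasurableSpace Ω] [MeasurableSpace 𝒳]
    {μ : Measure Ω} {Q : Measure 𝒳} {W : Ω → 𝒳} (hW : HasLaw W Q μ) (s : Set 𝒳) :
    μ (W ⁻¹' s) ≤ Q s :=
  (Measure.le_map_apply hW.aemeasurable s).trans (by rw [hW.map_eq])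

section Covariates

variable {d : ℕ} {M ρ : ℝ} {P : Measure (EuclideanSpace ℝ (Fin d) × ℝ)}

lemma IsRegularDesign.ae_covariate (h : IsRegularDesign M ρ P) :
    ∀ᵐ x ∂(covariateLaw P), ∀ j, |x j| ≤ M := by
  rw [covariateLaw, ae_map_iff measurable_fst.aemeasurable]
  · exact h.bounded
  · simp only [Set.ofPred_forall]
    exact MeasurableSet.iInter fun j => measurableSet_le (by fun_prop) measurable_const

lemma IsRegularDesign.integral_exp_covariate (h : IsRegularDesign M ρ P)
    (v : EuclideanSpace ℝ (Fin d)) :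
    ∫ x, Real.exp (inner ℝ x v) ∂(covariateLaw P) ≤ Real.exp (M ^ 2 * ‖v‖ ^ 2 / 2) := by
  rw [covariateLaw, integral_map measurable_fst.aemeasurable
    (Measurable.aestronglyMeasurable (by fun_prop))]
  exact h.subGaussian v

lemma IsRegularDesign.quadratic_covariate [IsProbabilityMeasure P] (h : IsRegularDesign M ρ P)
    (v : EuclideanSpace ℝ (Fin d)) :
    ρ * ‖v‖ ^ 2 ≤ ∫ x, inner ℝ x v ^ 2 ∂(covariateLaw P) := by
  rw [covariateLaw, integral_map measurable_fst.aemeasurable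
    (Measurable.aestronglyMeasurable (by fun_prop))]
  exact h.quadratic_ge v

end Covariates

/-! ### The finite-sample error bound. -/

/-- The restricted strong convexity event in terms of the residuals. -/
theorem measure_design_event_le {d n : ℕ} (hn : 1 ≤ n) (hd : 1 ≤ d) {M ρ M₀ : ℝ} (hρ : 0 < ρ)
    {σ : ℝ≥0} {P : Measure (EuclideanSpace ℝ (Fin d) × ℝ)} [IsProbabilityMeasure P]
    (h : IsRegularDesign M ρ P) {θ₀ : EuclideanSpace ℝ (Fin d)} (hθ : ‖θ₀‖ ≤ M₀) :
    (Measure.pi fun _ => noiseLaw σ (covariateLaw P))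
      {w : Fin n → EuclideanSpace ℝ (Fin d) × ℝ | ∃ h, ‖h‖ = 1 ∧
        l1Norm h ≤ coneConst M ρ (truncLevel M ρ M₀) / rate n d ∧
        ∑ i, truncSq (truncLevel M ρ M₀) θ₀ h (w i).1 < n * (ρ / 4)} ≤ ENNReal.ofReal (1 / n) := by
  have hτ : 0 < truncLevel M ρ M₀ := zero_lt_one.trans_le (one_le_truncLevel hρ M M₀)
  have h1 := measure_truncSq_cone_le (ν := covariateLaw P) hn hd hρ hτ h.ae_covariate θ₀
    fun v hv => half_le_integral_truncSq hρ h.ae_covariate h.integral_exp_covariate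
      h.quadratic_covariate hθ hv
  have h2 : MeasurePreserving (fun (w : Fin n → EuclideanSpace ℝ (Fin d) × ℝ) i => (w i).1)
      (Measure.pi fun _ => noiseLaw σ (covariateLaw P))
      (Measure.pi fun _ => covariateLaw P) :=
    measurePreserving_pi _ _ fun _ => measurePreserving_fst
  exact (measure_preimage_le_of_hasLaw h2.hasLaw _).trans h1

/-- Finite-sample error bound, valid with high probability. -/
theorem measure_error_gt_le {n d : ℕ} (hn : 1 ≤ n) {f : ℝ → ℝ} (hf : IsRegularLink f) {B : ℝ}
    (hB0 : 0 ≤ B) (hB : ∀ t, |f t| ≤ B) (hLip : ∀ s t, |f s - f t| ≤ B * |s - t|) {σ : ℝ≥0}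
    {M ρ M₀ c : ℝ} (hρ : 0 < ρ) (hc : 0 < c)
    (hder : ∀ t, |t| ≤ truncLevel M ρ M₀ + 1 → c ≤ deriv f t)
    {θ₀ : EuclideanSpace ℝ (Fin d)} (hθ₀ : θ₀ ≠ 0) (hθM : ‖θ₀‖ ≤ M₀)
    {P : Measure (EuclideanSpace ℝ (Fin d) × ℝ)} [IsProbabilityMeasure P]
    (hdes : IsRegularDesign M ρ P) (hmod : IsGaussianSingleIndex f σ θ₀ P)
    {Ω : Type*} [MeasurableSpace Ω] {μ : Measure Ω} [IsProbabilityMeasure μ]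
    {Z : Fin n → Ω → EuclideanSpace ℝ (Fin d) × ℝ} (hind : iIndepFun Z μ)
    (hlaw : ∀ i, HasLaw (Z i) P μ) {lam C : ℝ} {θhat : Ω → EuclideanSpace ℝ (Fin d)}
    (hlam : (2 * B ^ 2 * σ ^ 2 * M ^ 2 + 16) * rate n d ≤ lam) (hC : lam ≤ C * rate n d)
    (hmin : ∀ᵐ ω ∂μ, IsMinOn (criterion f lam fun i => Z i ω) Set.univ (θhat ω))
    (h5 : 8 * (rate n d * l1Norm θ₀) ≤ 1)
    (h6 : 16 * C * (rate n d * l1Norm θ₀) < c ^ 2 * (ρ / 4) * (1 / truncLevel M ρ M₀ ^ 2)) :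
    μ {ω | (2 + 64 / coneConst M ρ (truncLevel M ρ M₀) ^ 2 + 128 * C / (c ^ 2 * (ρ / 4))) *
        (numNonzero θ₀ * rate n d) < l1Norm (θhat ω - θ₀)} ≤
      ENNReal.ofReal (((∫ x, |x| ∂(gaussianReal 0 (σ ^ 2))) + (B + 2)) / √n) +
        ENNReal.ofReal (1 / n) := by
  have hd : 1 ≤ d := by
    by_contra hcon
    obtain rfl : d = 0 := by lia
    exact hθ₀ (Subsingleton.elim _ _)
  have hτ : 0 < truncLevel M ρ M₀ := zero_lt_one.trans_le (one_le_truncLevel hρ M M₀)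
  have ha := coneConst_pos (M := M) hρ hτ
  have hW := hasLaw_residuals hf.differentiable.continuous.measurable hmod hind hlaw
  have hE1 := (measure_preimage_le_of_hasLaw hW _).trans
    (measure_noise_event_le hn hd hB0 hLip hB (σ := σ) hdes.ae_covariate θ₀)
  have hE2 := (measure_preimage_le_of_hasLaw hW _).trans
    (measure_design_event_le hn hd hρ (σ := σ) hdes hθM)
  refine le_trans ?_ (add_le_add hE1 hE2)
  refine le_trans (measure_mono_ae ?_) (measure_union_le _ _)
  filter_upwards [hmin] with ω hω hbad
  by_contra hgood
  refine absurd hbad (not_lt.2 ?_)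
  refine l1Norm_error_le hn hd hθ₀ (z := fun i => Z i ω) (lam := lam)
    (K := 2 * B ^ 2 * σ ^ 2 * M ^ 2 + 16) (τ := truncLevel M ρ M₀) (by positivity) ha
    (by positivity) (hω (Set.mem_univ _)) hlam hC
    (fun h => not_lt.1 fun hlt => hgood (Or.inl ⟨h, hlt⟩)) ?_ h5 h6
  exact fun h hh hcone => empirical_growth hf.differentiable hf.deriv_pos' hc hτ hder θ₀
    (fun i => (Z i ω).1)
    (fun v h1 h2 => not_lt.1 fun hlt => hgood (Or.inr ⟨v, h1, h2, hlt⟩)) h hh hcone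

/-! ### From finite samples to the asymptotic rate. -/

/-- For `nd ≥ 2` one has `4nd ≤ (nd)⁴`. The case `n = d = 1`, where `log (nd) = 0`, must be
excluded. -/
lemma rate_le_two_mul {n d : ℕ} (hn : 2 ≤ n) (hd : 1 ≤ d) :
    rate n d ≤ 2 * √(Real.log (n * d) / n) := by
  have hn2 : (2 : ℝ) ≤ n := by exact_mod_cast hn
  have hd1 : (1 : ℝ) ≤ d := by exact_mod_cast hd
  have hnd : (2 : ℝ) ≤ n * d := by nlinarith
  have h1 : Real.log (4 * n * d) ≤ 4 * Real.log (n * d) := by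
    have e : (4 : ℝ) * Real.log (n * d) = Real.log ((n * d) ^ 4) := by
      rw [Real.log_pow]; norm_num
    rw [e]
    refine Real.log_le_log (by positivity) ?_
    have h2 : (2 : ℝ) ^ 3 ≤ (n * d : ℝ) ^ 3 := by gcongr
    nlinarith
  calc rate n d ≤ √(2 ^ 2 * (Real.log (n * d) / n)) := by
        refine Real.sqrt_le_sqrt ?_
        rw [← mul_div_assoc]
        gcongr
        linarith
    _ = 2 * √(Real.log (n * d) / n) := by
        rw [Real.sqrt_mul (by positivity), Real.sqrt_sq (by norm_num)]

lemma rate_mul_sq_le {n d : ℕ} (hn : 2 ≤ n) (hd : 1 ≤ d) (t : ℝ) :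
    (rate n d * t) ^ 2 ≤ 4 * (Real.log (n * d) * t ^ 2 / n) := by
  have hn2 : (2 : ℝ) ≤ n := by exact_mod_cast hn
  have hd1 : (1 : ℝ) ≤ d := by exact_mod_cast hd
  have hlog : 0 ≤ Real.log (n * d) := Real.log_nonneg (by nlinarith)
  have h1 := pow_le_pow_left₀ (rate_pos (by lia) hd).le (rate_le_two_mul hn hd) 2
  rw [mul_pow, Real.sq_sqrt (by positivity)] at h1
  calc (rate n d * t) ^ 2 = rate n d ^ 2 * t ^ 2 := by ring
    _ ≤ 2 ^ 2 * (Real.log (n * d) / n) * t ^ 2 := by gcongr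
    _ = _ := by ring

end SparseNLS

theorem mainTheorem6 (f : ℝ → ℝ) (hf : SparseNLS.IsRegularLink f) (σ : ℝ≥0)
    (M_X ρ_X M₀ : ℝ) (hρ : 0 < ρ_X) :
    ∃ K : ℝ, 0 < K ∧
      ∀ (d : ℕ → ℕ) (θ₀ : ∀ n, EuclideanSpace ℝ (Fin (d n)))
        (P : ∀ n, Measure (EuclideanSpace ℝ (Fin (d n)) × ℝ))
        (Ω : ℕ → Type*) [∀ n, MeasurableSpace (Ω n)] (μ : ∀ n, Measure (Ω n))
        [∀ n, IsProbabilityMeasure (P n)] [∀ n, IsProbabilityMeasure (μ n)]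
        (Z : ∀ n, Fin n → Ω n → EuclideanSpace ℝ (Fin (d n)) × ℝ)
        (lam : ℕ → ℝ) (θhat : ∀ n, Ω n → EuclideanSpace ℝ (Fin (d n))),
        -- the true parameters and the population laws
        (∀ n, 1 ≤ n → θ₀ n ≠ 0 ∧ ‖θ₀ n‖ ≤ M₀) →
        (∀ n, 1 ≤ n → SparseNLS.IsRegularDesign M_X ρ_X (P n)) →
        (∀ n, 1 ≤ n → SparseNLS.IsGaussianSingleIndex f σ (θ₀ n) (P n)) →
        -- the samples are i.i.d.
        (∀ n, 1 ≤ n → iIndepFun (Z n) (μ n) ∧ ∀ i, HasLaw (Z n i) (P n) (μ n)) →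
        -- the sparsity condition
        Tendsto (fun n : ℕ => Real.log (n * d n) * SparseNLS.l1Norm (θ₀ n) ^ 2 / n) atTop (𝓝 0) →
        -- the penalty level: at least `K √(log (4nd) / n)`, and of this order
        (∀ n : ℕ, 1 ≤ n → K * √(Real.log (4 * n * d n) / n) ≤ lam n) →
        (∃ C : ℝ, ∀ᶠ n : ℕ in atTop, lam n ≤ C * √(Real.log (4 * n * d n) / n)) →
        -- the estimator is a minimizer of the criterion over the whole space
        (∀ n, 1 ≤ n → ∀ᵐ ω ∂(μ n),
          IsMinOn (SparseNLS.criterion f (lam n) (fun i => Z n i ω)) Set.univ (θhat n ω)) →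
        SparseNLS.IsBigOP μ (fun n ω => SparseNLS.l1Norm (θhat n ω - θ₀ n))
          (fun n : ℕ => SparseNLS.numNonzero (θ₀ n) * √(Real.log (n * d n) / n)) := by
  obtain ⟨B, hB0, hB, hLip⟩ := hf.exists_bound
  refine ⟨2 * B ^ 2 * σ ^ 2 * M_X ^ 2 + 16, by positivity, ?_⟩
  intro d θ₀ P Ω _ μ _ _ Z lam θhat hθ hdes hmod hiid hsparse hlam hlamO hmin δ hδ
  obtain ⟨C, hC⟩ := hlamO
  set τ := SparseNLS.truncLevel M_X ρ_X M₀
  have hτ : 0 < τ := zero_lt_one.trans_le (SparseNLS.one_le_truncLevel hρ M_X M₀)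
  obtain ⟨c, hc, hder⟩ := hf.deriv_pos (τ + 1) (by positivity)
  have ha := SparseNLS.coneConst_pos (M := M_X) hρ hτ
  set a := SparseNLS.coneConst M_X ρ_X τ
  set A := (∫ x, |x| ∂(gaussianReal 0 (σ ^ 2))) + (B + 2)
  refine ⟨2 * (2 + 64 / a ^ 2 + 128 * |C| / (c ^ 2 * (ρ_X / 4))), by positivity, ?_⟩
  -- A threshold for `rate * |θ₀|₁` that meets both smallness conditions of `measure_error_gt_le`;
  -- the sparsity condition brings this product below it eventually.
  obtain ⟨η, hη, hη1, hη2⟩ : ∃ η > 0, 8 * η ≤ 1 ∧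
      16 * |C| * η < c ^ 2 * (ρ_X / 4) * (1 / τ ^ 2) := by
    have hκ : 0 < c ^ 2 * (ρ_X / 4) * (1 / τ ^ 2) := by positivity
    refine ⟨min (1 / 8) (c ^ 2 * (ρ_X / 4) * (1 / τ ^ 2) / (16 * |C| + 1)), by positivity, ?_, ?_⟩
    · linarith [min_le_left (1 / 8) (c ^ 2 * (ρ_X / 4) * (1 / τ ^ 2) / (16 * |C| + 1))]
    · calc 16 * |C| * min (1 / 8) (c ^ 2 * (ρ_X / 4) * (1 / τ ^ 2) / (16 * |C| + 1))
          ≤ 16 * |C| * (c ^ 2 * (ρ_X / 4) * (1 / τ ^ 2) / (16 * |C| + 1)) := by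
            gcongr; exact min_le_right _ _
        _ < (16 * |C| + 1) * (c ^ 2 * (ρ_X / 4) * (1 / τ ^ 2) / (16 * |C| + 1)) := by
            gcongr; linarith
        _ = _ := by field_simp
  have hsmall := hsparse.eventually_lt_const (show (0 : ℝ) < η ^ 2 / 4 by positivity)
  have hprob : Tendsto (fun n : ℕ => A / √(n : ℝ) + 1 / n) atTop (𝓝 0) := by
    have h1 : Tendsto (fun n : ℕ => √(n : ℝ)) atTop atTop :=
      Real.tendsto_sqrt_atTop.comp tendsto_natCast_atTop_atTop
    simpa using (h1.const_div_atTop A).add tendsto_one_div_atTop_nhds_zero_nat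
  filter_upwards [hC, hsmall, hprob.eventually_lt_const hδ, eventually_ge_atTop 2]
    with n hCn hsn hpn hn2
  have hn : 1 ≤ n := by lia
  obtain ⟨hne, hle⟩ := hθ n hn
  have hd : 1 ≤ d n := by
    by_contra hcon
    have h0 : d n = 0 := by lia
    have : IsEmpty (Fin (d n)) := by rw [h0]; infer_instance
    exact hne (Subsingleton.elim _ _)
  have hr := SparseNLS.rate_pos hn hd
  have ht := SparseNLS.l1Norm_nonneg (θ₀ n)
  have hrt : SparseNLS.rate n (d n) * SparseNLS.l1Norm (θ₀ n) ≤ η := by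
    refine (pow_le_pow_iff_left₀ (by positivity) hη.le two_ne_zero).1 ?_
    have := SparseNLS.rate_mul_sq_le hn2 hd (SparseNLS.l1Norm (θ₀ n))
    linarith
  have hC' : lam n ≤ |C| * SparseNLS.rate n (d n) :=
    hCn.trans (mul_le_mul_of_nonneg_right (le_abs_self C) hr.le)
  have hmain := SparseNLS.measure_error_gt_le hn hf hB0 hB hLip hρ hc hder hne hle (hdes n hn)
    (hmod n hn) (hiid n hn).1 (hiid n hn).2 (hlam n hn) hC' (hmin n hn) (by linarith)
    (lt_of_le_of_lt (by gcongr) hη2)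
  rw [← ENNReal.ofReal_add (by positivity) (by positivity)] at hmain
  refine (measure_mono fun ω hω => ?_).trans (hmain.trans (ENNReal.ofReal_le_ofReal hpn.le))
  rw [Set.mem_ofPred_eq] at hω ⊢
  rw [abs_of_nonneg (SparseNLS.l1Norm_nonneg _), abs_of_nonneg (by positivity :
    0 ≤ SparseNLS.numNonzero (θ₀ n) * √(Real.log (n * d n) / n))] at hω
  refine lt_of_le_of_lt ?_ hω
  have h1 := SparseNLS.rate_le_two_mul hn2 hd
  calc _ ≤ (2 + 64 / a ^ 2 + 128 * |C| / (c ^ 2 * (ρ_X / 4))) *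
        (SparseNLS.numNonzero (θ₀ n) * (2 * √(Real.log (n * d n) / n))) := by gcongr
    _ = _ := by ring
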